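/- Let $d_x,d_y,N\ge 1$ be integers. A GRU cell of width $d$ has parameters $W_*,U_*\in\mathbb{R}^{d\times d}$, $b_*\in\mathbb{R}^d$ ($*=r,h,z$) and maps a sequence $(x[t])_{t\ge1}$ in $\mathbb{R}^d$ to the sequence $(h[t])_{t\ge 1}$ in $\mathbb{R}^d$ given by $h[0]=0$ and \begin{align*} r[t+1]&=\sigma_{\mathrm{sig}}\bigl(W_rx[t+1]+U_rh[t]+b_r\bigr),\\ \tilde h[t+1]&=\tanh\bigl(W_hx[t+1]+U_h(r[t+1]\odot h[t])+b_h\bigr),\\ z[t+1]&=\sigma_{\mathrm{sig}}\bigl(W_zx[t+1]+U_zh[t]+b_z\bigr),\\ h[t+1]&=(1-z[t+1])\odot h[t]+z[t+1]\odot\tilde h[t+1], \end{align*} where $\sigma_{\mathrm{sig}}(u)=1/(1+e^{-u})$, functions act componentwise and $\odot$ is the componentwise product. A deep GRU of width $d$ is a map $\mathcal{N}=\mathcal{Q}\circ\mathcal{R}_L\circ\cdots\circ\mathcal{R}_1\circ\mathcal{P}$ with $L\ge2$, where $\mathcal{R}_1,\dots,\mathcal{R}_L$ are GRU cells of width $d$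 and $\mathcal{P}(x)[t]=Px[t]$, $\mathcal{Q}(s)[t]=Qs[t]$ for matrices $P\in\mathbb{R}^{d\times d_x}$, $Q\in\mathbb{R}^{d_y\times d}$; it maps $\mathbb{R}^{d_x\times N}$ to $\mathbb{R}^{d_y\times N}$. A function $f:\mathbb{R}^{d_x\times N}\to\mathbb{R}^{d_y\times N}$ is past-dependent if, for every $t$, $f(x)[t]$ is a function of $x[1],\dots,x[t]$ only. Let $f:\mathbb{R}^{d_x\times N}\to\mathbb{R}^{d_y\times N}$ be past-dependent, $K\subset\mathbb{R}^{d_x}$ compact and $\epsilon>0$. (1) If $f$ is continuous, there is a deep GRU $\mathcal{N}$ of width $d_x+d_y+3$ such that $$\sup_{x\in K^N}\sup_{1\le t\le N}\|f(x)[t]-\mathcal{N}(x)[t]\|<\epsilon .$$ (2) If $1\le p<\infty$ and $f\in L^p(K^N,\mathbb{R}^{d_y\times N})$ (Lebesgue measure; $f$ need not be continuous), there is a deep GRU $\mathcal{N}$ of width $\max\{d_x+1,d_y\}+1$ such that $$\sup_{1\le t\le N}\|f(x)[t]-\mathcal{N}(x)[t]\|_{L^p(K^N)}<\epsilon .$$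 -/

import Mathlib

open MeasureTheory
open scoped ENNReal Matrix

noncomputable section

/-- Parameters of a GRU cell acting on `d`-dimensional hidden states. -/
structure GRUCell (d : ℕ) where
  Wr : Matrix (Fin d) (Fin d) ℝ
  Ur : Matrix (Fin d) (Fin d) ℝ
  br : Fin d → ℝ
  Wh : Matrix (Fin d) (Fin d) ℝ
  Uh : Matrix (Fin d) (Fin d) ℝ
  bh : Fin d → ℝ
  Wz : Matrix (Fin d) (Fin d) ℝ
  Uz : Matrix (Fin d) (Fin d) ℝ
  bz : Fin d → ℝ

namespace GRUCell

variable {d : ℕ}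

/-- Reset gate `r[t+1]`, as a function of the token `x = x[t+1]` and the state `h = h[t]`. -/
def resetGate (c : GRUCell d) (x h : Fin d → ℝ) : Fin d → ℝ :=
  fun i => Real.sigmoid ((c.Wr *ᵥ x + c.Ur *ᵥ h + c.br) i)

/-- Update gate `z[t+1]`. -/
def updateGate (c : GRUCell d) (x h : Fin d → ℝ) : Fin d → ℝ :=
  fun i => Real.sigmoid ((c.Wz *ᵥ x + c.Uz *ᵥ h + c.bz) i)

/-- Candidate state; the product `*` of vectors is the component-wise one. -/
def candidate (c : GRUCell d) (x h : Fin d → ℝ) : Fin d → ℝ :=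
  fun i => Real.tanh ((c.Wh *ᵥ x + c.Uh *ᵥ (c.resetGate x h * h) + c.bh) i)

/-- The new state `h[t+1]`. -/
def step (c : GRUCell d) (x h : Fin d → ℝ) : Fin d → ℝ :=
  (1 - c.updateGate x h) * h + c.updateGate x h * c.candidate x h

/-- The states `h[0] = 0, h[1], h[2], …`. Sequences of tokens are indexed from `0`, so that `x t`
is the `(t+1)`-st token. -/
def state (c : GRUCell d) (x : ℕ → Fin d → ℝ) : ℕ → Fin d → ℝ
  | 0 => 0
  | t + 1 => c.step (x t) (c.state x t)

/-- The sequence-to-sequence map of the cell: the `(t+1)`-st output token is `h[t+1]`. -/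
def run (c : GRUCell d) (x : ℕ → Fin d → ℝ) : ℕ → Fin d → ℝ :=
  fun t => c.state x (t + 1)

end GRUCell

/-- A GRU network of width `d`: a token-wise linear lifting map with matrix `P`, a finite stack of
GRU cells (listed from the first to the last) and a token-wise linear projection with matrix `Q`. -/
structure GRUNetwork (dx dy d : ℕ) where
  P : Matrix (Fin d) (Fin dx) ℝ
  cells : List (GRUCell d)
  Q : Matrix (Fin dy) (Fin d) ℝ

namespace GRUNetwork

variable {dx dy d : ℕ}

/-- A network is deep if it has at least two layers. -/
def IsDeep (𝒩 : GRUNetwork dx dy d) : Prop := 2 ≤ 𝒩.cells.length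

/-- The map `Q ∘ R_L ∘ ⋯ ∘ R_1 ∘ P` on infinite sequences of tokens. -/
def eval (𝒩 : GRUNetwork dx dy d) (x : ℕ → Fin dx → ℝ) : ℕ → Fin dy → ℝ :=
  fun t => 𝒩.Q *ᵥ (𝒩.cells.foldl (fun s c => c.run s) (fun k => 𝒩.P *ᵥ x k)) t

/-- The map of the network on sequences of length `N`. The tokens after the `N`-th one, set to zero
here, have no influence on the first `N` output tokens. -/
def toFun (𝒩 : GRUNetwork dx dy d) {N : ℕ} (x : Fin N → EuclideanSpace ℝ (Fin dx)) :
    Fin N → EuclideanSpace ℝ (Fin dy) :=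
  fun t => WithLp.toLp 2
    (𝒩.eval (fun k => if h : k < N then (x ⟨k, h⟩).ofLp else 0) t)

end GRUNetwork

/-- `f` is past-dependent: the `t`-th output token is a function of the input tokens up to
time `t`. -/
def PastDependent {N : ℕ} {X Y : Type*} (f : (Fin N → X) → Fin N → Y) : Prop :=
  ∃ g : (t : Fin N) → (Set.Iic t → X) → Y, ∀ x t, f x t = g t (fun s => x s)

/-- The set `K^N` of sequences of length `N` with all tokens in `K`. -/
def tokensIn {X : Type*} (N : ℕ) (K : Set X) : Set (Fin N → X) := {x | ∀ t, x t ∈ K}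

end

open Filter Topology

/-! Work in the closure, for the compact-open topology, of the maps computed by non-empty stacks of
cells followed by a token-wise matrix. This closure is stable under composition
(`comp_mem_stackClosure`), because the matrix between two stacks is absorbed by the next cell. It
contains every recurrent layer that applies `tanh` to chosen coordinates of an affine map of input
and state and is affine in the others (`exists_idealLayer_mem`): fix the reset gate at `1/2`, let
the update gate tend to `1`, and rescale the affine coordinates into the range where `tanh` is
nearly the identity.

The coordinates then act as registers. One spare register computes a `tanh` neuron and the next
layer adds it to the output registers, so composition of layers becomes addition of neurons
(`exists_readWrite_mem`). Density of shallow `tanh` networks (`mem_of_tanh_mem`) turns sums of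
neurons into arbitrary continuous functions.

For the uniform statement, two more registers form linear functionals of the whole past by a Horner
scheme (`exists_horner_mem`). A constant channel in the past tells the time, so a continuous
past-dependent `f` is one continuous function of the past (`ofPast_past`). Inputs, outputs and three
spare registers give the width `dx + dy + 3`.

For the `L^p` statement the past must fit into a single number. After replacing `f` by a continuous
past-dependent function, cut `K`, up to a small set, into finitely many small disjoint compact sets.
The labels of the tokens are digits, and an affine recurrence accumulates them into a code
(`digitCode_inj`). The inputs can then be erased. The code is moved injectively close to the first
output entry, so one register is both an output and the memory from which the other outputs are
decoded (`exists_decoder`, `exists_codeNetwork`). Outside the good set only a bound independent of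
the accuracy is needed (`exists_codeNetwork_near`). -/

/-- Extension of a finite sequence by zero. -/
def zeroExtend {V : Type*} [Zero V] {N : ℕ} (u : Fin N → V) : ℕ → V :=
  fun k => if h : k < N then u ⟨k, h⟩ else 0

theorem zeroExtend_val {V : Type*} [Zero V] {N : ℕ} (u : Fin N → V) (t : Fin N) :
    zeroExtend u t = u t := by
  simp [zeroExtend]

theorem continuous_zeroExtend_apply {V : Type*} [Zero V] [TopologicalSpace V] {N : ℕ} (k : ℕ) :
    Continuous fun u : Fin N → V => zeroExtend u k := by
  by_cases h : k < N
  · simpa [zeroExtend, h] using continuous_apply _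
  · simpa [zeroExtend, h] using continuous_const

/-- The states of a recurrent cell with transition function `F`, starting from `0`. -/
def recState {U V : Type*} [Zero V] (F : U → V → V) (x : ℕ → U) : ℕ → V
  | 0 => 0
  | t + 1 => F (x t) (recState F x t)

theorem continuous_recState {A U V : Type*} [Zero V] [TopologicalSpace A] [TopologicalSpace U]
    [TopologicalSpace V] {F : A → U → V → V}
    (hF : Continuous fun q : A × U × V => F q.1 q.2.1 q.2.2) {x : A → ℕ → U}
    (hx : ∀ k, Continuous fun a => x a k) (t : ℕ) :
    Continuous fun a => recState (F a) (x a) t := by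
  induction t with
  | zero => exact continuous_const
  | succ t ih => exact hF.comp (continuous_id.prodMk ((hx t).prodMk ih))

/-- The layer with transition function `F a` on sequences of length `N`, depending continuously on
the parameter `a`. -/
def recLayer {A V : Type*} [Zero V] [TopologicalSpace A] [TopologicalSpace V] (N : ℕ)
    (F : A → V → V → V) (hF : Continuous fun q : A × V × V => F q.1 q.2.1 q.2.2) :
    C(A, C(Fin N → V, Fin N → V)) :=
  ContinuousMap.curry
    ⟨fun q t => recState (F q.1) (zeroExtend q.2) (t + 1), by
      refine continuous_pi fun t => ?_
      refine continuous_recState (A := A × (Fin N → V)) (F := fun q => F q.1) ?_ ?_ _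
      · exact hF.comp ((continuous_fst.comp continuous_fst).prodMk continuous_snd)
      · exact fun k => (continuous_zeroExtend_apply k).comp continuous_snd⟩

@[simp] theorem recLayer_apply {A V : Type*} [Zero V] [TopologicalSpace A] [TopologicalSpace V]
    (N : ℕ) (F : A → V → V → V) (hF : Continuous fun q : A × V × V => F q.1 q.2.1 q.2.2) (a : A)
    (u : Fin N → V) (t : Fin N) :
    recLayer N F hF a u t = recState (F a) (zeroExtend u) (t + 1) := rfl

/-! ### Stacks of cells and their closure under composition -/

namespace GRUCell

variable {d : ℕ}

/-- The output of a stack of cells. -/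
noncomputable def stack (cs : List (GRUCell d)) (x : ℕ → Fin d → ℝ) : ℕ → Fin d → ℝ :=
  cs.foldl (fun s c => c.run s) x

theorem state_congr (c : GRUCell d) {x y : ℕ → Fin d → ℝ} {t : ℕ} (h : ∀ k < t, x k = y k) :
    c.state x t = c.state y t := by
  induction t with
  | zero => rfl
  | succ t ih => simp [state, h t (by omega), ih fun k hk => h k (by omega)]

/-- Causality of stacks: padding a finite sequence cannot affect the outputs inside its range. -/
theorem stack_congr (cs : List (GRUCell d)) {x y : ℕ → Fin d → ℝ} {t : ℕ}
    (h : ∀ k ≤ t, x k = y k) : stack cs x t = stack cs y t := by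
  induction cs generalizing x y with
  | nil => exact h t le_rfl
  | cons c cs ih => exact ih fun k hk => c.state_congr fun j hj => h j (by omega)

/-- The cell that first multiplies its input by a matrix. -/
def precomp (c : GRUCell d) (M : Matrix (Fin d) (Fin d) ℝ) : GRUCell d :=
  { c with Wr := c.Wr * M, Wh := c.Wh * M, Wz := c.Wz * M }

theorem precomp_step (c : GRUCell d) (M : Matrix (Fin d) (Fin d) ℝ) (x h : Fin d → ℝ) :
    (c.precomp M).step x h = c.step (M *ᵥ x) h := by
  have hr : (c.precomp M).resetGate x h = c.resetGate (M *ᵥ x) h := by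
    funext i
    simp [resetGate, precomp, Matrix.mulVec_mulVec]
  have hz : (c.precomp M).updateGate x h = c.updateGate (M *ᵥ x) h := by
    funext i
    simp [updateGate, precomp, Matrix.mulVec_mulVec]
  have hc : (c.precomp M).candidate x h = c.candidate (M *ᵥ x) h := by
    funext i
    simp only [candidate, hr]
    simp [precomp, Matrix.mulVec_mulVec]
  simp [step, hz, hc]

theorem precomp_run (c : GRUCell d) (M : Matrix (Fin d) (Fin d) ℝ) (x : ℕ → Fin d → ℝ) :
    (c.precomp M).run x = c.run fun k => M *ᵥ x k := by
  funext t
  simp only [run]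
  induction t + 1 with
  | zero => rfl
  | succ t ih => simp [state, ih, precomp_step]

end GRUCell

open GRUCell

/-- The maps on sequences of length `N` computed by a stack of at least `n` GRU cells followed by a
token-wise linear map. -/
def stackMaps (d N n : ℕ) : Set C(Fin N → Fin d → ℝ, Fin N → Fin d → ℝ) :=
  {T | ∃ (cs : List (GRUCell d)) (M : Matrix (Fin d) (Fin d) ℝ), n ≤ cs.length ∧
    ∀ u t, T u t = M *ᵥ stack cs (zeroExtend u) t}

theorem comp_mem_stackMaps {d N m n : ℕ} {S T : C(Fin N → Fin d → ℝ, Fin N → Fin d → ℝ)}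
    (hS : S ∈ stackMaps d N m) (hT : T ∈ stackMaps d N n) : S.comp T ∈ stackMaps d N (m + n) := by
  obtain ⟨cs, M, hm, hS⟩ := hS
  obtain ⟨ds, L, hn, hT⟩ := hT
  have key (u : Fin N → Fin d → ℝ) (t : Fin N) :
      S (T u) t = M *ᵥ stack cs (fun k => L *ᵥ stack ds (zeroExtend u) k) t := by
    rw [hS]
    congr 1
    refine stack_congr cs fun k hk => ?_
    have := hT u ⟨k, by omega⟩
    simpa [zeroExtend, show k < N by omega] using this
  cases cs with
  | nil =>
    -- With no cell left to absorb `L`, the two output matrices are multiplied instead.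
    refine ⟨ds, M * L, by simpa using Nat.add_le_add hm hn, fun u t => ?_⟩
    simp [key, stack, Matrix.mulVec_mulVec]
  | cons c cs =>
    refine ⟨ds ++ c.precomp L :: cs, M, ?_, fun u t => ?_⟩
    · simp only [List.length_append, List.length_cons] at *
      omega
    · simp [key, stack, precomp_run]

theorem comp_mem_closure_stackMaps {d N m n : ℕ}
    {S T : C(Fin N → Fin d → ℝ, Fin N → Fin d → ℝ)} (hS : S ∈ closure (stackMaps d N m))
    (hT : T ∈ closure (stackMaps d N n)) : S.comp T ∈ closure (stackMaps d N (m + n)) := by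
  refine map_mem_closure₂ (f := fun S T : C(Fin N → Fin d → ℝ, Fin N → Fin d → ℝ) => S.comp T) ?_
    hS hT fun _ h _ h' => comp_mem_stackMaps h h'
  exact ContinuousMap.continuous_comp'.comp continuous_swap

/-- The closure, in the compact-open topology, of the maps computed by non-empty stacks. -/
def stackClosure (d N : ℕ) : Set C(Fin N → Fin d → ℝ, Fin N → Fin d → ℝ) :=
  closure (stackMaps d N 1)

theorem isClosed_stackClosure (d N : ℕ) : IsClosed (stackClosure d N) := isClosed_closure

theorem comp_mem_stackClosure {d N : ℕ} {S T : C(Fin N → Fin d → ℝ, Fin N → Fin d → ℝ)}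
    (hS : S ∈ stackClosure d N) (hT : T ∈ stackClosure d N) : S.comp T ∈ stackClosure d N :=
  by
  have h : stackMaps d N (1 + 1) ⊆ stackMaps d N 1 :=
    fun _ ⟨cs, M, h, h'⟩ => ⟨cs, M, by omega, h'⟩
  exact closure_mono h (comp_mem_closure_stackMaps hS hT)

/-! ### Partly linear `tanh` layers as limits of single cells -/

/-- The family `y ↦ tanh (e * y) / e`, with value `y` at `e = 0`. -/
noncomputable def scaledTanh (e y : ℝ) : ℝ := y * dslope Real.tanh 0 (e * y)

theorem hasDerivAt_tanh_zero : HasDerivAt Real.tanh 1 0 := by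
  have h : HasDerivAt (fun x => Real.sinh x / Real.cosh x) _ 0 :=
    (Real.hasDerivAt_sinh 0).div (Real.hasDerivAt_cosh 0) (by simp)
  rw [show Real.tanh = fun x => Real.sinh x / Real.cosh x from
    funext Real.tanh_eq_sinh_div_cosh]
  simpa using h

theorem continuous_tanh_real : Continuous Real.tanh := by
  rw [show Real.tanh = fun x => Real.sinh x / Real.cosh x from
    funext Real.tanh_eq_sinh_div_cosh]
  exact Real.continuous_sinh.div Real.continuous_cosh fun x => (Real.cosh_pos x).ne'

theorem continuous_scaledTanh : Continuous fun q : ℝ × ℝ => scaledTanh q.1 q.2 := by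
  have h : Continuous (dslope Real.tanh 0) := by
    rw [← continuousOn_univ, continuousOn_dslope univ_mem]
    exact ⟨continuous_tanh_real.continuousOn, hasDerivAt_tanh_zero.differentiableAt⟩
  exact continuous_snd.mul (h.comp (continuous_fst.mul continuous_snd))

@[simp] theorem scaledTanh_zero (y : ℝ) : scaledTanh 0 y = y := by
  simp [scaledTanh, dslope_same, hasDerivAt_tanh_zero.deriv]

theorem mul_scaledTanh (e y : ℝ) : e * scaledTanh e y = Real.tanh (e * y) := by
  have := sub_smul_dslope Real.tanh 0 (e * y)
  simp only [sub_zero, Real.tanh_zero, smul_eq_mul] at this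
  rw [scaledTanh, ← mul_assoc, this]

@[simp] theorem scaledTanh_one (y : ℝ) : scaledTanh 1 y = Real.tanh y := by
  simpa using mul_scaledTanh 1 y

theorem exists_sigmoid_eq {z : ℝ} (h0 : 0 < z) (h1 : z < 1) : ∃ b, Real.sigmoid b = z := by
  have : z ∈ Set.range Real.sigmoid := by rw [Real.range_sigmoid]; exact ⟨h0, h1⟩
  exact this

section IdealLayer

variable {d : ℕ} (N : ℕ) (A B : (Fin d → ℝ) →ₗ[ℝ] Fin d → ℝ) (b : Fin d → ℝ) (a : Finset (Fin d))

/-- The scale of a coordinate: `1` if it is activated, `δ` if it is to become linear. -/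
def coordScale (a : Finset (Fin d)) (δ : ℝ) (i : Fin d) : ℝ := if i ∈ a then 1 else δ

/-- The rescaled transition function of a GRU cell whose update gate is `1 - δ`. -/
noncomputable def relaxedStep (δ : ℝ) (u h : Fin d → ℝ) : Fin d → ℝ := fun i =>
  δ * h i + (1 - δ) * scaledTanh (coordScale a δ i) (A u i + B h i + b i)

/-- Continuity includes `δ = 0`, where `tanh (δ y) / δ` is read as `y`; this is what permits the
limit `δ → 0` of whole layers. -/
theorem continuous_relaxedStep : Continuous fun q : ℝ × (Fin d → ℝ) × (Fin d → ℝ) =>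
    relaxedStep A B b a q.1 q.2.1 q.2.2 := by
  have hA := A.continuous_of_finiteDimensional
  have hB := B.continuous_of_finiteDimensional
  refine continuous_pi fun i => ?_
  have hs : Continuous fun δ : ℝ => coordScale a δ i := by
    unfold coordScale
    split_ifs <;> fun_prop
  have := continuous_scaledTanh.comp (((hs.comp continuous_fst).prodMk (g := fun
    q : ℝ × (Fin d → ℝ) × (Fin d → ℝ) => A q.2.1 i + B q.2.2 i + b i) (by fun_prop)))
  simp only [Function.comp_def] at this
  unfold relaxedStep
  fun_prop

theorem relaxedStep_mem {δ : ℝ} (h0 : 0 < δ) (h1 : δ < 1) :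
    recLayer N (relaxedStep A B b a) (continuous_relaxedStep A B b a) δ ∈ stackMaps d N 1 := by
  obtain ⟨z, hz⟩ := exists_sigmoid_eq (z := 1 - δ) (by linarith) (by linarith)
  set e := coordScale a δ with he
  have hpos : ∀ i, e i ≠ 0 := fun i => by
    simp only [he, coordScale]; split_ifs <;> positivity
  let D := Matrix.diagonal e
  let D' := Matrix.diagonal fun i => (e i)⁻¹
  -- Both gates are constant: the reset gate is `sigmoid 0 = 1/2`, cancelled by the factor `2` in
  -- `Uh`, and the update gate is `1 - δ`. The state of `c` is the relaxed state scaled by `e`; the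
  -- output matrix `D'` undoes the scaling.
  let c : GRUCell d :=
    { Wr := 0, Ur := 0, br := 0, Wh := D * LinearMap.toMatrix' A,
      Uh := (2 : ℝ) • (D * LinearMap.toMatrix' B * D'), bh := fun i => e i * b i
      Wz := 0, Uz := 0, bz := fun _ => z }
  have hstep (x h : Fin d → ℝ) :
      c.step x (fun i => e i * h i) = fun i => e i * relaxedStep A B b a δ x h i := by
    have hU : c.Uh *ᵥ (c.resetGate x (fun i => e i * h i) * fun i => e i * h i)
        = fun i => e i * B h i := by
      have h1 : D' *ᵥ (c.resetGate x (fun i => e i * h i) * fun i => e i * h i)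
          = (2⁻¹ : ℝ) • h := by
        funext i
        simp only [D', Matrix.mulVec_diagonal, Pi.mul_apply, resetGate, c, Matrix.zero_mulVec,
          Pi.zero_apply, add_zero, Real.sigmoid_zero, Pi.smul_apply, smul_eq_mul]
        field_simp [hpos i]
      simp only [c] at h1 ⊢
      rw [Matrix.smul_mulVec, ← Matrix.mulVec_mulVec, h1, ← Matrix.mulVec_mulVec,
        LinearMap.toMatrix'_mulVec, map_smul, Matrix.mulVec_smul, smul_smul]
      funext i
      simp [D, Matrix.mulVec_diagonal]
    have hW : c.Wh *ᵥ x = fun i => e i * A x i := by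
      simp only [c]
      rw [← Matrix.mulVec_mulVec, LinearMap.toMatrix'_mulVec]
      funext i
      simp [D, Matrix.mulVec_diagonal]
    funext i
    simp only [step, candidate, hU, hW, Pi.add_apply, Pi.mul_apply, Pi.sub_apply, Pi.one_apply,
      updateGate]
    simp only [c, Matrix.zero_mulVec, Pi.zero_apply, zero_add, hz, relaxedStep, ← he]
    rw [mul_add, mul_left_comm (e i), mul_left_comm (e i), mul_scaledTanh, ← mul_add, ← mul_add]
    ring_nf
  have hstate (x : ℕ → Fin d → ℝ) (t : ℕ) :
      c.state x t = fun i => e i * recState (relaxedStep A B b a δ) x t i := by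
    induction t with
    | zero => simp [state, recState]; rfl
    | succ t ih => rw [state, ih, hstep]; rfl
  refine ⟨[c], D', le_rfl, fun u t => ?_⟩
  rw [recLayer_apply]
  funext i
  simp only [stack, List.foldl_cons, List.foldl_nil, run, D', Matrix.mulVec_diagonal, hstate]
  rw [inv_mul_cancel_left₀ (hpos i)]

/-- The transition function of a layer that applies `tanh` to the coordinates in `a` and is linear
in the others. -/
noncomputable def idealStep (u h : Fin d → ℝ) : Fin d → ℝ := fun i =>
  if i ∈ a then Real.tanh (A u i + B h i + b i) else A u i + B h i + b i

theorem relaxedStep_zero : relaxedStep A B b a 0 = idealStep A B b a := by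
  funext u h i
  simp only [relaxedStep, idealStep, coordScale]
  split_ifs <;> simp

theorem exists_idealLayer_mem : ∃ T ∈ stackClosure d N, ∀ u t,
    T u t = recState (idealStep A B b a) (zeroExtend u) (t + 1) := by
  refine ⟨recLayer N (relaxedStep A B b a) (continuous_relaxedStep A B b a) 0, ?_, fun u t => ?_⟩
  · have h := ((recLayer N (relaxedStep A B b a)
      (continuous_relaxedStep A B b a)).continuous.tendsto 0).mono_left
        (nhdsWithin_le_nhds (s := Set.Ioi 0))
    refine mem_closure_of_tendsto h ?_
    filter_upwards [Ioo_mem_nhdsGT (zero_lt_one' ℝ)] with δ hδ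
    exact relaxedStep_mem N A B b a hδ.1 hδ.2
  · rw [recLayer_apply, relaxedStep_zero]

end IdealLayer

/-! ### Density of shallow `tanh` networks -/

section Density

variable {κ ζ : Type*} [Fintype κ] [Fintype ζ]

/-- The exponential of a linear form. -/
noncomputable def expForm (w : κ → ℝ) : C(κ → ℝ, ℝ) :=
  ⟨fun y => Real.exp (w ⬝ᵥ y), by unfold dotProduct; fun_prop⟩

/-- The span of the exponentials of linear forms. -/
noncomputable def expAlgebra (κ : Type*) [Fintype κ] : Subalgebra ℝ C(κ → ℝ, ℝ) :=
  Algebra.adjoin ℝ (Set.range expForm)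

/-- Products of exponentials of linear forms are again such exponentials, so the generated algebra
is no larger than their linear span. -/
theorem mem_span_of_mem_expAlgebra {g : C(κ → ℝ, ℝ)} (hg : g ∈ expAlgebra κ) :
    g ∈ Submodule.span ℝ (Set.range (expForm (κ := κ))) := by
  let P : Submonoid C(κ → ℝ, ℝ) :=
    { carrier := Set.range expForm
      one_mem' := ⟨0, by ext y; simp [expForm]⟩
      mul_mem' := by
        rintro _ _ ⟨v, rfl⟩ ⟨w, rfl⟩
        exact ⟨v + w, by ext y; simp [expForm, Real.exp_add, add_dotProduct]⟩ }
  rw [← Subalgebra.mem_toSubmodule, expAlgebra, Algebra.adjoin_eq_span] at hg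
  have : Submonoid.closure (Set.range (expForm (κ := κ))) ≤ P := Submonoid.closure_le.2 le_rfl
  exact Submodule.span_mono this hg

theorem expAlgebra_separatesPoints [DecidableEq κ] : (expAlgebra κ).SeparatesPoints := by
  intro x y hxy
  obtain ⟨i, hi⟩ := Function.ne_iff.1 hxy
  refine ⟨expForm (Pi.single i 1), ⟨_, Algebra.subset_adjoin ⟨_, rfl⟩, rfl⟩, ?_⟩
  simpa [expForm] using hi

/-- The product of a scalar function and a vector. -/
noncomputable def smulVec (k : C(κ → ℝ, ℝ)) (z : ζ → ℝ) : C(κ → ℝ, ζ → ℝ) :=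
  ⟨fun y => k y • z, by fun_prop⟩

/-- As `r → 0` the left side tends to `exp x`, which makes an exponential a limit of a `tanh` neuron
plus a constant. -/
theorem exp_div_one_add_mul_exp_eq_tanh {r x : ℝ} (hr : 0 < r) :
    Real.exp x / (1 + r * Real.exp x)
      = 1 / (2 * r) * Real.tanh (2⁻¹ * x + 2⁻¹ * Real.log r) + 1 / (2 * r) := by
  have hE : 0 < Real.exp (2⁻¹ * x + 2⁻¹ * Real.log r) := Real.exp_pos _
  have h2 : Real.exp (2⁻¹ * x + 2⁻¹ * Real.log r) ^ 2 = r * Real.exp x := by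
    rw [← Real.exp_nat_mul]
    push_cast
    rw [mul_add, mul_inv_cancel_left₀ two_ne_zero, mul_inv_cancel_left₀ two_ne_zero, Real.exp_add,
      Real.exp_log hr, mul_comm]
  rw [Real.tanh_eq, Real.exp_neg]
  set E := Real.exp (2⁻¹ * x + 2⁻¹ * Real.log r)
  have hx : Real.exp x = E ^ 2 / r := by field_simp; linarith
  rw [hx]
  have : E ^ 2 + 1 ≠ 0 := by positivity
  field_simp
  ring

/-- Shallow `tanh` networks are dense. -/
theorem mem_of_tanh_mem [DecidableEq κ] [DecidableEq ζ] {S : Set C(κ → ℝ, ζ → ℝ)}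
    (hS : IsClosed S) (hadd : ∀ f ∈ S, ∀ g ∈ S, f + g ∈ S)
    (htanh : ∀ (w : κ → ℝ) (b : ℝ) (z : ζ → ℝ) (h : C(κ → ℝ, ζ → ℝ)),
      (∀ y, h y = Real.tanh (w ⬝ᵥ y + b) • z) → h ∈ S) (h : C(κ → ℝ, ζ → ℝ)) : h ∈ S := by
  have hconst (z : ζ → ℝ) : ContinuousMap.const _ z ∈ S := by
    have h1 : Real.tanh 1 ≠ 0 := by
      rw [Real.tanh_eq_sinh_div_cosh]
      exact div_ne_zero (Real.sinh_pos_iff.2 one_pos).ne' (Real.cosh_pos 1).ne'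
    refine htanh 0 1 ((Real.tanh 1)⁻¹ • z) _ fun y => ?_
    simp [smul_smul, h1]
  have hexp (w : κ → ℝ) (z : ζ → ℝ) : smulVec (expForm w) z ∈ S := by
    -- The absolute value keeps the denominator positive for every real `q.1`, so the family is
    -- continuous through `0`; only positive parameters are used in the limit.
    have hcont : Continuous fun q : ℝ × (κ → ℝ) =>
        (Real.exp (w ⬝ᵥ q.2) / (1 + |q.1| * Real.exp (w ⬝ᵥ q.2))) • z := by
      unfold dotProduct
      have h1 : Continuous fun q : ℝ × (κ → ℝ) => Real.exp (∑ i, w i * q.2 i) := by fun_prop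
      have h2 : Continuous fun q : ℝ × (κ → ℝ) => 1 + |q.1| * Real.exp (∑ i, w i * q.2 i) := by
        fun_prop
      exact (h1.div h2 fun q => by positivity).smul continuous_const
    let G : C(ℝ, C(κ → ℝ, ζ → ℝ)) := ContinuousMap.curry ⟨_, hcont⟩
    have hlim := (G.continuous.tendsto 0).mono_left (nhdsWithin_le_nhds (s := Set.Ioi 0))
    have h0 : G 0 = smulVec (expForm w) z := by
      ext y i
      simp [G, smulVec, expForm]
    rw [← h0]
    refine hS.mem_of_tendsto hlim ?_
    filter_upwards [self_mem_nhdsWithin] with r hr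
    have hr : 0 < r := hr
    have hd : G r = smulVec ⟨fun y => Real.tanh (((2⁻¹ : ℝ) • w) ⬝ᵥ y + 2⁻¹ * Real.log r), by
        unfold dotProduct; exact continuous_tanh_real.comp (by fun_prop)⟩ ((1 / (2 * r)) • z)
        + ContinuousMap.const _ ((1 / (2 * r)) • z) := by
      ext y i
      simp only [G, smulVec, ContinuousMap.curry_apply, ContinuousMap.coe_mk, abs_of_pos hr,
        exp_div_one_add_mul_exp_eq_tanh hr, ContinuousMap.add_apply, ContinuousMap.const_apply,
        Pi.smul_apply, Pi.add_apply, smul_dotProduct, smul_eq_mul]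
      ring
    rw [hd]
    exact hadd _ (htanh _ _ _ _ fun y => rfl) _ (hconst _)
  have hspan (g : C(κ → ℝ, ℝ)) (hg : g ∈ expAlgebra κ) : ∀ z : ζ → ℝ, smulVec g z ∈ S := by
    have hg' := mem_span_of_mem_expAlgebra hg
    clear hg
    induction hg' using Submodule.span_induction with
    | mem x hx =>
      obtain ⟨w, rfl⟩ := hx
      exact hexp w
    | zero =>
      intro z
      convert hconst 0
      ext; simp [smulVec]
    | add f g _ _ ihf ihg =>
      intro z
      convert hadd _ (ihf z) _ (ihg z) using 1
      ext; simp [smulVec, add_mul]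
    | smul c f _ ih =>
      intro z
      convert ih (c • z) using 1
      ext; simp [smulVec]; ring
  have hscalar (k : C(κ → ℝ, ℝ)) (z : ζ → ℝ) : smulVec k z ∈ S := by
    have hmap : Continuous fun k : C(κ → ℝ, ℝ) => smulVec k z :=
      ContinuousMap.continuous_of_continuous_uncurry _ (by
        simp only [Function.uncurry_def, smulVec, ContinuousMap.coe_mk]
        fun_prop)
    have hk : k ∈ closure (expAlgebra κ : Set C(κ → ℝ, ℝ)) := by
      rw [mem_closure_iff_nhds_basis
        (nhds_basis_uniformity' Metric.uniformity_basis_dist.compactConvergenceUniformity)]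
      rintro ⟨C, ε⟩ ⟨hC, hε⟩
      obtain ⟨g, hg, h⟩ :=
        ContinuousMap.exists_mem_subalgebra_near_continuous_of_isCompact_of_separatesPoints
          expAlgebra_separatesPoints k hC hε
      refine ⟨g, hg, fun x hx => ?_⟩
      have := h x hx
      rwa [← dist_eq_norm, dist_comm] at this
    exact (hS.preimage hmap).closure_subset_iff.2 (fun g hg => hspan g hg z) hk
  have hsum : h = ∑ j, smulVec ⟨fun y => h y j, by fun_prop⟩ (Pi.single j 1) := by
    ext y i
    simp [smulVec, ContinuousMap.sum_apply, Pi.single_apply]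
  rw [hsum]
  refine Finset.sum_induction _ (· ∈ S) (fun f g hf hg => hadd f hf g hg) (hconst 0)
    fun j _ => hscalar _ _

end Density

/-! ### Registers: writing functions of tokens and of the past -/

section ReadWrite

variable {d N : ℕ}

theorem exists_linearLayer_mem (N : ℕ) (A B : (Fin d → ℝ) →ₗ[ℝ] Fin d → ℝ) (b : Fin d → ℝ) :
    ∃ T ∈ stackClosure d N, ∀ u t,
      T u t = recState (fun x h => A x + B h + b) (zeroExtend u) (t + 1) := by
  obtain ⟨T, hT, h⟩ := exists_idealLayer_mem N A B b ∅
  refine ⟨T, hT, fun u t => ?_⟩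
  rw [h]
  congr 1

theorem exists_tokenwiseLinear_mem (N : ℕ) (A : (Fin d → ℝ) →ₗ[ℝ] Fin d → ℝ) :
    ∃ T ∈ stackClosure d N, ∀ u t, T u t = A (u t) := by
  obtain ⟨T, hT, h⟩ := exists_linearLayer_mem N A 0 0
  refine ⟨T, hT, fun u t => ?_⟩
  simp [h, recState, zeroExtend_val]

/-- Setting the coordinates in `s` to zero. -/
def clear (s : Finset (Fin d)) : (Fin d → ℝ) →ₗ[ℝ] Fin d → ℝ where
  toFun u i := if i ∈ s then 0 else u i
  map_add' u v := by ext i; by_cases h : i ∈ s <;> simp [h]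
  map_smul' c u := by ext i; by_cases h : i ∈ s <;> simp [h]

theorem clear_apply (s : Finset (Fin d)) (u : Fin d → ℝ) (i : Fin d) :
    clear s u i = if i ∈ s then 0 else u i := rfl

@[simp] theorem clear_clear (s : Finset (Fin d)) (u : Fin d → ℝ) :
    clear s (clear s u) = clear s u := by
  funext i
  simp only [clear_apply]
  split_ifs <;> rfl

/-- Multiplication of a coordinate with a vector. -/
def coordSMul (i : Fin d) (v : Fin d → ℝ) : (Fin d → ℝ) →ₗ[ℝ] Fin d → ℝ :=
  (LinearMap.proj i).smulRight v

@[simp] theorem coordSMul_apply (i : Fin d) (v u : Fin d → ℝ) : coordSMul i v u = u i • v := rfl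

theorem exists_activation_mem (N : ℕ) (τ : Fin d) (l : (Fin d → ℝ) →ₗ[ℝ] ℝ) (b : ℝ) :
    ∃ T ∈ stackClosure d N, ∀ u t,
      T u t = clear {τ} (u t) + Real.tanh (l (u t) + b) • Pi.single τ 1 := by
  obtain ⟨T, hT, h⟩ := exists_idealLayer_mem N (clear {τ} + l.smulRight (Pi.single τ 1)) 0
    (b • Pi.single τ 1) {τ}
  refine ⟨T, hT, fun u t => ?_⟩
  rw [h, recState, zeroExtend_val]
  funext i
  by_cases hi : i = τ
  · subst hi
    simp [idealStep, clear_apply]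
  · simp [idealStep, clear_apply, hi]

/-- The past of a sequence, as seen from time `t`: the entry at `(k, some i)` is the `i`-th entry
of the token at time `t - k`, and the entries at `(k, none)` with `k ≤ t` are `1`. -/
def past {κ : Type*} (N : ℕ) (ρ : (Fin d → ℝ) →ₗ[ℝ] κ → ℝ) (u : Fin N → Fin d → ℝ) (t : Fin N) :
    Fin N × Option κ → ℝ :=
  fun j => if j.1 ≤ t then j.2.elim 1 fun i => ρ (zeroExtend u (t - j.1)) i else 0

theorem continuous_past {κ : Type*} (N : ℕ) (ρ : (Fin d → ℝ) →ₗ[ℝ] κ → ℝ) : Continuous (past N ρ) := by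
  have hρ := ρ.continuous_of_finiteDimensional
  refine continuous_pi fun t => continuous_pi fun j => ?_
  unfold past
  split_ifs
  · rcases j with ⟨k, _ | i⟩
    · exact continuous_const
    · exact (continuous_apply i).comp (hρ.comp (continuous_zeroExtend_apply _))
  · exact continuous_const

variable {κ ζ : Type*} [Fintype κ] [Fintype ζ] [DecidableEq κ] [DecidableEq ζ]

/-- If a network can add every `tanh` neuron of a read-out `R`, which is not affected by this,
to the registers in the range of `q`, then it can add every continuous function of `R`. -/
theorem exists_readWrite_mem (s : Finset (Fin d)) (q : (ζ → ℝ) →ₗ[ℝ] Fin d → ℝ)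
    (hq : ∀ z, clear s (q z) = q z) (R : C(Fin N → Fin d → ℝ, Fin N → κ → ℝ))
    (hR : ∀ (u : Fin N → Fin d → ℝ) (z : Fin N → ζ → ℝ),
      R (fun t => clear s (u t) + q (z t)) = R u)
    (htanh : ∀ (w : κ → ℝ) (b : ℝ) (z : ζ → ℝ), ∃ T ∈ stackClosure d N, ∀ u t,
      T u t = clear s (u t) + Real.tanh (w ⬝ᵥ R u t + b) • q z) (h : C(κ → ℝ, ζ → ℝ)) :
    ∃ T ∈ stackClosure d N, ∀ u t, T u t = clear s (u t) + q (h (R u t)) := by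
  have hcl := (clear s).continuous_of_finiteDimensional
  have hqc := q.continuous_of_finiteDimensional
  let Φ (h : C(κ → ℝ, ζ → ℝ)) : C(Fin N → Fin d → ℝ, Fin N → Fin d → ℝ) :=
    ⟨fun u t => clear s (u t) + q (h (R u t)), by fun_prop⟩
  have hΦ : Continuous Φ :=
    ContinuousMap.continuous_of_continuous_uncurry _ (by
      simp only [Function.uncurry_def, Φ, ContinuousMap.coe_mk]
      fun_prop)
  refine ⟨Φ h, mem_of_tanh_mem (S := Φ ⁻¹' stackClosure d N)
    ((isClosed_stackClosure d N).preimage hΦ) ?_ ?_ h, fun u t => rfl⟩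
  · intro f hf g hg
    -- Depth replaces width: what `Φ g` writes does not alter the read-out, so `Φ f` still sees the
    -- original `R u` and adds its own term.
    have : Φ (f + g) = (Φ f).comp (Φ g) := by
      ext u t i
      have h1 := hR u fun t => g (R u t)
      simp only [Φ, ContinuousMap.comp_apply, ContinuousMap.coe_mk, h1, map_add, clear_clear, hq,
        ContinuousMap.add_apply, Pi.add_apply]
      ring
    rw [Set.mem_preimage, this]
    exact comp_mem_stackClosure hf hg
  · intro w b z h hh
    obtain ⟨T, hT, hTu⟩ := htanh w b z
    have : Φ h = T := by
      ext u t i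
      simp [Φ, hTu, hh]
    rwa [Set.mem_preimage, this]

/-- Token-wise functions of some registers can be added to other registers, with the help of one
more register `τ`. -/
theorem exists_tokenwise_mem (N : ℕ) (τ : Fin d) (ρ : (Fin d → ℝ) →ₗ[ℝ] κ → ℝ)
    (q : (ζ → ℝ) →ₗ[ℝ] Fin d → ℝ) (hρ : ∀ u, ρ (clear {τ} u) = ρ u)
    (hq : ∀ z, clear {τ} (q z) = q z) (hρq : ∀ z, ρ (q z) = 0) (h : C(κ → ℝ, ζ → ℝ)) :
    ∃ T ∈ stackClosure d N, ∀ u t, T u t = clear {τ} (u t) + q (h (ρ (u t))) := by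
  have hρc := ρ.continuous_of_finiteDimensional
  refine exists_readWrite_mem {τ} q hq ⟨fun u t => ρ (u t), by fun_prop⟩ ?_ ?_ h
  · intro u z
    funext t
    simp [hρ, hρq]
  · intro w b z
    obtain ⟨T, hT, h⟩ := exists_activation_mem N τ (dotProductBilin ℝ ℝ w ∘ₗ ρ) b
    obtain ⟨T', hT', h'⟩ := exists_tokenwiseLinear_mem N (clear {τ} + coordSMul τ (q z))
    refine ⟨T'.comp T, comp_mem_stackClosure hT' hT, fun u t => ?_⟩
    have h2 : clear {τ} (Pi.single τ 1) = (0 : Fin d → ℝ) := by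
      funext i
      by_cases hi : i = τ <;> simp [clear_apply, hi]
    simp [h, h', h2, clear_apply]

/-- Linear functions of the past can be stored in one register `s`, with the help of one more
register `p`. -/
theorem exists_horner_mem (N : ℕ) {s p : Fin d} (hsp : s ≠ p) (n : ℕ)
    (α : ℕ → (Fin d → ℝ) →ₗ[ℝ] ℝ) (β : ℕ → ℝ) (hα : ∀ k u, α k (clear {s, p} u) = α k u) :
    ∃ T ∈ stackClosure d N, ∀ u t, clear {s, p} (T u t) = clear {s, p} (u t) ∧
      T u t s = ∑ k ∈ Finset.range n,
        if k ≤ (t : ℕ) then α k (zeroExtend u (t - k)) + β k else 0 := by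
  induction n generalizing α β with
  | zero =>
    obtain ⟨T, hT, h⟩ := exists_tokenwiseLinear_mem N (clear {s, p})
    refine ⟨T, hT, fun u t => ⟨?_, ?_⟩⟩
    · simp [h]
    · simp [h, clear_apply]
  | succ n ih =>
    obtain ⟨T, hT, h⟩ := ih (fun k => α (k + 1)) (fun k => β (k + 1)) fun k => hα (k + 1)
    -- Horner step: `p` stores the incoming value of `s`, and the recurrence adds to `s` the `p` of
    -- the previous time. The sum with shifted coefficients thus arrives delayed by one step, and
    -- the new term `α 0 + β 0` joins it. At time `0` the initial state contributes nothing.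
    obtain ⟨H, hH, h'⟩ := exists_linearLayer_mem N
      (clear {s, p} + (α 0).smulRight (Pi.single s 1) + coordSMul s (Pi.single p 1))
      (coordSMul p (Pi.single s 1)) (β 0 • Pi.single s 1)
    refine ⟨H.comp T, comp_mem_stackClosure hH hT, fun u t => ⟨?_, ?_⟩⟩
    · rw [← (h u t).1]
      funext i
      by_cases hi : i = s ∨ i = p
      · simp [clear_apply, hi]
      · have h1 : i ≠ s := fun h => hi (.inl h)
        have h2 : i ≠ p := fun h => hi (.inr h)
        simp [clear_apply, h1, h2, h', recState, zeroExtend_val]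
    · have hα0 : α 0 (T u t) = α 0 (u t) := by rw [← hα, (h u t).1, hα]
      obtain ⟨t, ht⟩ := t
      cases t with
      | zero =>
        rw [Finset.sum_range_succ']
        have := zeroExtend_val (T u) ⟨0, ht⟩
        have h4 := zeroExtend_val u ⟨0, ht⟩
        simp only at this hα0 h4
        simp [h', recState, this, clear_apply, hα0, h4, hsp]
      | succ t =>
        have ht' : t < N := by omega
        rw [Finset.sum_range_succ']
        have h1 := zeroExtend_val (T u) ⟨t + 1, ht⟩
        have h2 := zeroExtend_val (T u) ⟨t, ht'⟩
        have h3 := (h u ⟨t, ht'⟩).2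
        have h4 := zeroExtend_val u ⟨t + 1, ht⟩
        simp only at h1 h2 h3 h4 hα0
        simp [h', recState, h1, h2, clear_apply, hα0, h3, h4, hsp, hsp.symm]
        ring

/-- Functions of the past of some registers can be added to other registers, with the help of three
more registers. -/
theorem exists_pastDependent_mem (N : ℕ) {s p τ : Fin d} (hsp : s ≠ p)
    (ρ : (Fin d → ℝ) →ₗ[ℝ] κ → ℝ) (q : (ζ → ℝ) →ₗ[ℝ] Fin d → ℝ)
    (hρ : ∀ u, ρ (clear {s, p, τ} u) = ρ u) (hq : ∀ z, clear {s, p, τ} (q z) = q z)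
    (hρq : ∀ z, ρ (q z) = 0) (h : C(Fin N × Option κ → ℝ, ζ → ℝ)) :
    ∃ T ∈ stackClosure d N, ∀ u t, T u t = clear {s, p, τ} (u t) + q (h (past N ρ u t)) := by
  refine exists_readWrite_mem {s, p, τ} q hq ⟨past N ρ, continuous_past N ρ⟩ ?_ ?_ h
  · intro u z
    funext t j
    rcases j with ⟨k, _ | i⟩
    · simp [past]
    · simp only [ContinuousMap.coe_mk, past, Option.elim_some, zeroExtend]
      split_ifs <;> simp [hρ, hρq]
  · intro w b z
    -- The weights of `w` at delay `k` split into a linear part `α k`, acting on the token, and the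
    -- weight `β k` of the constant channel.
    let α (k : ℕ) : (Fin d → ℝ) →ₗ[ℝ] ℝ :=
      if hk : k < N then dotProductBilin ℝ ℝ (fun i => w (⟨k, hk⟩, some i)) ∘ₗ ρ else 0
    let β (k : ℕ) : ℝ := if hk : k < N then w (⟨k, hk⟩, none) else 0
    have hρ' (u : Fin d → ℝ) : ρ (clear {s, p} u) = ρ u := by
      rw [← hρ, ← hρ u]
      congr 1
      funext i
      by_cases h1 : i = s <;> by_cases h2 : i = p <;> by_cases h3 : i = τ <;>
        simp [clear_apply, h1, h2, h3]
    obtain ⟨T₁, hT₁, h₁⟩ := exists_horner_mem N hsp N α β fun k u => by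
      by_cases hk : k < N <;> simp [α, hk, hρ']
    obtain ⟨T₂, hT₂, h₂⟩ := exists_activation_mem N τ (LinearMap.proj s) b
    obtain ⟨T₃, hT₃, h₃⟩ := exists_tokenwiseLinear_mem N (clear {s, p, τ} + coordSMul τ (q z))
    refine ⟨T₃.comp (T₂.comp T₁), comp_mem_stackClosure hT₃ (comp_mem_stackClosure hT₂ hT₁),
      fun u t => ?_⟩
    have hdot : T₁ u t s = w ⬝ᵥ past N ρ u t := by
      rw [(h₁ u t).2, Finset.sum_range, dotProduct, Fintype.sum_prod_type]
      refine Finset.sum_congr rfl fun k _ => ?_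
      rw [Fintype.sum_option]
      by_cases hk : k ≤ t
      · have hk' : (k : ℕ) ≤ t := hk
        simp only [past, hk, hk', if_true, Option.elim_none, Option.elim_some, α, β, k.2, dite_true]
        simp [dotProductBilin, dotProduct, add_comm]
      · have hk' : ¬ (k : ℕ) ≤ t := hk
        simp [past, hk, hk']
    have hclear : clear {s, p, τ} (T₂ (T₁ u) t) = clear {s, p, τ} (u t) := by
      funext i
      by_cases hi : i = s ∨ i = p ∨ i = τ
      · simp [clear_apply, hi]
      · push Not at hi
        have := congrFun (h₁ u t).1 i
        simp only [clear_apply, Finset.mem_insert, Finset.mem_singleton, hi.1, hi.2.1, or_self,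
          if_false] at this
        simp [clear_apply, hi, h₂, this]
    have hτ : T₂ (T₁ u) t τ = Real.tanh (w ⬝ᵥ past N ρ u t + b) := by
      simp [h₂, clear_apply, hdot]
    simp [h₃, hclear, hτ]

end ReadWrite

/-! ### From the closure to deep networks -/

theorem isCompact_tokensIn {X : Type*} [TopologicalSpace X] (N : ℕ) {K : Set X}
    (hK : IsCompact K) : IsCompact (tokensIn N K) := by
  have : tokensIn N K = Set.univ.pi fun _ => K := by
    ext x
    simp [tokensIn]
  rw [this]
  exact isCompact_univ_pi fun _ => hK

theorem exists_network_near {d dx dy N : ℕ} {T : C(Fin N → Fin d → ℝ, Fin N → Fin d → ℝ)}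
    (hT : T ∈ stackClosure d N) (P : (Fin dx → ℝ) →ₗ[ℝ] Fin d → ℝ)
    (Q : (Fin d → ℝ) →ₗ[ℝ] Fin dy → ℝ) {K : Set (EuclideanSpace ℝ (Fin dx))} (hK : IsCompact K)
    {ε : ℝ} (hε : 0 < ε) :
    ∃ 𝒩 : GRUNetwork dx dy d, 𝒩.IsDeep ∧ ∀ x ∈ tokensIn N K, ∀ t,
      ‖WithLp.toLp 2 (Q (T (fun k => P (x k).ofLp) t)) - 𝒩.toFun x t‖ < ε := by
  -- Composing with the identity, itself in the closure, secures at least two cells and hence a deep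
  -- network.
  obtain ⟨I, hI, hI'⟩ := exists_tokenwiseLinear_mem (d := d) N LinearMap.id
  have hTI : T.comp I = T := by
    have h (u : Fin N → Fin d → ℝ) : I u = u := funext fun t => by simp [hI']
    ext u t i
    simp [h]
  have hT2 := comp_mem_closure_stackMaps hT hI
  rw [hTI] at hT2
  have hP := P.continuous_of_finiteDimensional
  have hcont : Continuous fun (x : Fin N → EuclideanSpace ℝ (Fin dx)) k => P (x k).ofLp := by
    fun_prop
  let L : (Fin d → ℝ) →L[ℝ] EuclideanSpace ℝ (Fin dy) :=
    LinearMap.toContinuousLinearMap ((WithLp.linearEquiv 2 ℝ (Fin dy → ℝ)).symm.toLinearMap ∘ₗ Q)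
  have hL (v : Fin d → ℝ) : L v = WithLp.toLp 2 (Q v) := rfl
  obtain ⟨T', ⟨cs, M, hcs, hT'⟩, hTT'⟩ := (mem_closure_iff_nhds_basis
    (nhds_basis_uniformity' Metric.uniformity_basis_dist.compactConvergenceUniformity)).1 hT2
    ⟨_, ε / (‖L‖ + 1)⟩ ⟨(isCompact_tokensIn N hK).image hcont, by positivity⟩
  refine ⟨⟨LinearMap.toMatrix' P, cs, LinearMap.toMatrix' Q * M⟩, hcs, fun x hx t => ?_⟩
  have hnet : (GRUNetwork.mk (LinearMap.toMatrix' P) cs (LinearMap.toMatrix' Q * M)).toFun x t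
      = WithLp.toLp 2 (Q (T' (fun k => P (x k).ofLp) t)) := by
    have hx : (fun k => P (if h : k < N then (x ⟨k, h⟩).ofLp else 0))
        = zeroExtend fun k => P (x k).ofLp := by
      funext k
      by_cases h : k < N <;> simp [zeroExtend, h]
    simp only [GRUNetwork.toFun, GRUNetwork.eval, hT', ← Matrix.mulVec_mulVec,
      LinearMap.toMatrix'_mulVec, stack, hx]
  have h1 : dist (T (fun k => P (x k).ofLp)) (T' fun k => P (x k).ofLp) < ε / (‖L‖ + 1) :=
    hTT' _ ⟨x, hx, rfl⟩
  rw [hnet, ← hL, ← hL, ← map_sub]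
  calc ‖L (T (fun k => P (x k).ofLp) t - T' (fun k => P (x k).ofLp) t)‖
      ≤ ‖L‖ * dist (T (fun k => P (x k).ofLp)) (T' fun k => P (x k).ofLp) := by
        refine (L.le_opNorm _).trans ?_
        gcongr
        rw [← dist_eq_norm]
        exact dist_le_pi_dist _ _ t
    _ ≤ (‖L‖ + 1) * dist (T (fun k => P (x k).ofLp)) (T' fun k => P (x k).ofLp) := by
        gcongr
        linarith
    _ < ε := by
        rw [lt_div_iff₀ (by positivity)] at h1
        linarith

theorem PastDependent.congr {N : ℕ} {X Y : Type*} {f : (Fin N → X) → Fin N → Y}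
    (hf : PastDependent f) {x y : Fin N → X} {t : Fin N} (h : ∀ s ≤ t, x s = y s) :
    f x t = f y t := by
  obtain ⟨g, hg⟩ := hf
  rw [hg, hg]
  congr 1
  funext s
  exact h s s.2

/-! ### Uniform approximation -/

section Uniform

variable {dx dy N : ℕ}

/-- The tokens up to time `t` that are recorded in the past `w`. -/
def tokensOfPast (t : Fin N) (w : Fin N × Option (Fin dx) → ℝ) :
    Fin N → EuclideanSpace ℝ (Fin dx) :=
  fun k => WithLp.toLp 2 fun i => w (⟨t - k, by omega⟩, some i)

theorem continuous_tokensOfPast (t : Fin N) :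
    Continuous (tokensOfPast t : (Fin N × Option (Fin dx) → ℝ) → _) := by
  unfold tokensOfPast
  fun_prop

/-- A past-dependent function, as a function of the recorded past, from which the time is read
off. -/
noncomputable def ofPast (f : (Fin N → EuclideanSpace ℝ (Fin dx)) → Fin N → EuclideanSpace ℝ (Fin dy))
    (w : Fin N × Option (Fin dx) → ℝ) : Fin dy → ℝ :=
  ∑ t : Fin N, max 0 (1 - |∑ k, w (k, none) - ((t : ℝ) + 1)|) • (f (tokensOfPast t w) t).ofLp

theorem continuous_ofPast
    {f : (Fin N → EuclideanSpace ℝ (Fin dx)) → Fin N → EuclideanSpace ℝ (Fin dy)}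
    (hf : Continuous f) : Continuous (ofPast f) := by
  refine continuous_finsetSum _ fun t _ => ?_
  have h : Continuous fun w : Fin N × Option (Fin dx) → ℝ =>
      max 0 (1 - |∑ k, w (k, none) - ((t : ℝ) + 1)|) := by fun_prop
  refine h.smul ?_
  exact (PiLp.continuous_ofLp 2 _).comp
    ((continuous_apply t).comp (hf.comp (continuous_tokensOfPast t)))

/-- The constant channel serves as a clock. -/
theorem sum_past_none {d N : ℕ} {κ : Type*} (ρ : (Fin d → ℝ) →ₗ[ℝ] κ → ℝ)
    (u : Fin N → Fin d → ℝ) (t : Fin N) : ∑ k, past N ρ u t (k, none) = (t : ℝ) + 1 := by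
  simp only [past, Option.elim_none, Finset.sum_boole]
  have : (Finset.univ.filter fun k : Fin N => k ≤ t) = Finset.Iic t := by
    ext
    simp
  rw [this, Fin.card_Iic]
  push_cast
  ring

/-- The clock takes integer values and the tent functions have radius `1`, so only the summand of
the current time survives. Tokens after `t` are reconstructed wrongly, which past-dependence makes
harmless. -/
theorem ofPast_past {d : ℕ}
    {f : (Fin N → EuclideanSpace ℝ (Fin dx)) → Fin N → EuclideanSpace ℝ (Fin dy)}
    (hf : PastDependent f) (ρ : (Fin d → ℝ) →ₗ[ℝ] Fin dx → ℝ) (u : Fin N → Fin d → ℝ)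
    {x : Fin N → EuclideanSpace ℝ (Fin dx)} (hx : ∀ k, ρ (u k) = (x k).ofLp) (t : Fin N) :
    ofPast f (past N ρ u t) = (f x t).ofLp := by
  rw [ofPast, Finset.sum_eq_single t]
  · rw [sum_past_none, sub_self, abs_zero, sub_zero, max_eq_right zero_le_one, one_smul]
    congr 1
    refine hf.congr fun s hs => ?_
    have h1 : (⟨t - s, by omega⟩ : Fin N) ≤ t := Fin.mk_le_of_le_val (by simp)
    have h2 : (t : ℕ) - (t - s) = s := by
      have : (s : ℕ) ≤ t := hs
      omega
    ext i
    simp [tokensOfPast, past, h1, h2, zeroExtend_val, hx]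
  · intro b _ hb
    have h1 : (1 : ℝ) ≤ |(t : ℝ) + 1 - (b + 1)| := by
      have : ((t : ℕ) : ℤ) - (b : ℕ) ≠ 0 := fun h => hb (by ext; omega)
      have := Int.one_le_abs this
      have h2 : ((1 : ℤ) : ℝ) ≤ ((|((t : ℕ) : ℤ) - (b : ℕ)| : ℤ) : ℝ) := by exact_mod_cast this
      push_cast at h2
      rwa [add_sub_add_right_eq_sub]
    rw [sum_past_none, max_eq_left (by linarith), zero_smul]
  · simp

theorem exists_uniform_approximation
    {f : (Fin N → EuclideanSpace ℝ (Fin dx)) → Fin N → EuclideanSpace ℝ (Fin dy)}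
    (hf : PastDependent f) (hcont : Continuous f) {K : Set (EuclideanSpace ℝ (Fin dx))}
    (hK : IsCompact K) {ε : ℝ} (hε : 0 < ε) :
    ∃ 𝒩 : GRUNetwork dx dy (dx + dy + 3), 𝒩.IsDeep ∧
      ∀ x ∈ tokensIn N K, ∀ t, ‖f x t - 𝒩.toFun x t‖ < ε := by
  let ξ (i : Fin dx) : Fin (dx + dy + 3) := Fin.castAdd 3 (Fin.castAdd dy i)
  let υ (j : Fin dy) : Fin (dx + dy + 3) := Fin.castAdd 3 (Fin.natAdd dx j)
  let σ (k : Fin 3) : Fin (dx + dy + 3) := Fin.natAdd (dx + dy) k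
  have hξ : Function.Injective ξ := fun i j h => by
    simpa [ξ] using h
  have hυ : Function.Injective υ := fun i j h => by
    simpa [υ] using h
  have hξυ (i : Fin dx) : ¬ ∃ j, υ j = ξ i := fun ⟨j, h⟩ => by
    have := congrArg Fin.val h
    simp [ξ, υ] at this
    omega
  have hυξ (j : Fin dy) : ¬ ∃ i, ξ i = υ j := fun ⟨i, h⟩ => hξυ i ⟨j, h.symm⟩
  have hσξ (k : Fin 3) (i : Fin dx) : ξ i ≠ σ k := fun h => by
    have := congrArg Fin.val h
    simp [ξ, σ] at this
    omega
  have hσυ (k : Fin 3) (j : Fin dy) : υ j ≠ σ k := fun h => by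
    have := congrArg Fin.val h
    simp [υ, σ] at this
    omega
  let ρ : (Fin (dx + dy + 3) → ℝ) →ₗ[ℝ] Fin dx → ℝ := LinearMap.funLeft ℝ ℝ ξ
  let q : (Fin dy → ℝ) →ₗ[ℝ] Fin (dx + dy + 3) → ℝ := Function.ExtendByZero.linearMap ℝ υ
  let P : (Fin dx → ℝ) →ₗ[ℝ] Fin (dx + dy + 3) → ℝ := Function.ExtendByZero.linearMap ℝ ξ
  let Q : (Fin (dx + dy + 3) → ℝ) →ₗ[ℝ] Fin dy → ℝ := LinearMap.funLeft ℝ ℝ υ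
  have hq (z : Fin dy → ℝ) (k : Fin 3) : q z (σ k) = 0 :=
    Function.extend_apply' _ _ _ fun ⟨j, h⟩ => hσυ k j h
  obtain ⟨T, hT, h⟩ := exists_pastDependent_mem N (s := σ 0) (p := σ 1) (τ := σ 2)
    (by simp [σ]) ρ q
    (by
      intro u
      funext i
      simp [ρ, LinearMap.funLeft_apply, clear_apply, hσξ])
    (by
      intro z
      funext i
      simp only [clear_apply, Finset.mem_insert, Finset.mem_singleton]
      split_ifs with h
      · rcases h with rfl | rfl | rfl <;> simp [hq]
      · rfl)
    (by
      intro z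
      funext i
      exact Function.extend_apply' _ _ _ (hξυ i))
    ⟨ofPast f, continuous_ofPast hcont⟩
  obtain ⟨𝒩, hdeep, h𝒩⟩ := exists_network_near hT P Q hK hε
  refine ⟨𝒩, hdeep, fun x hx t => ?_⟩
  convert h𝒩 x hx t using 3
  have hρP (k : Fin N) : ρ (P (x k).ofLp) = (x k).ofLp := by
    funext i
    exact hξ.extend_apply _ _ i
  have hpast := ofPast_past hf ρ (fun k => P (x k).ofLp) hρP t
  ext j
  have h1 : P (x t).ofLp (υ j) = 0 := Function.extend_apply' _ _ _ (hυξ j)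
  have h2 (z : Fin dy → ℝ) : q z (υ j) = z j := hυ.extend_apply _ _ j
  simp [Q, LinearMap.funLeft_apply, h, clear_apply, hσυ, h1, h2, hpast]

end Uniform

/-! ### Coding the past in one number -/

/-- The number whose digits in base `β`, from the least significant one on, are
`x (t - 1), …, x 0`. -/
def digitCode {R : Type*} [Semiring R] (β : R) (x : ℕ → R) : ℕ → R :=
  recState (fun v h => v + β * h) x

theorem digitCode_succ {R : Type*} [Semiring R] (β : R) (x : ℕ → R) (t : ℕ) :
    digitCode β x (t + 1) = x t + β * digitCode β x t := rfl

theorem digitCode_natCast (β : ℕ) {x : ℕ → ℝ} {n : ℕ → ℕ} {t : ℕ} (h : ∀ k < t, x k = n k) :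
    digitCode (β : ℝ) x t = digitCode β n t := by
  induction t with
  | zero => simp [digitCode, recState]
  | succ t ih =>
    rw [digitCode_succ, digitCode_succ, ih fun k hk => h k (by omega), h t (by omega)]
    push_cast
    rfl

/-- Reduction modulo `M + 1` recovers the last digit. Since `0` is not a digit, the code also
determines the length, that is, the time. -/
theorem digitCode_inj {M : ℕ} {x y : ℕ → ℕ} {s t : ℕ} (hx : ∀ k < s, 1 ≤ x k ∧ x k ≤ M)
    (hy : ∀ k < t, 1 ≤ y k ∧ y k ≤ M) (h : digitCode (M + 1) x s = digitCode (M + 1) y t) :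
    s = t ∧ ∀ k < s, x k = y k := by
  induction s generalizing t with
  | zero =>
    cases t with
    | zero => simp
    | succ t =>
      rw [digitCode_succ] at h
      have := hy t (by omega)
      simp [digitCode, recState] at h
      omega
  | succ s ih =>
    have hxs := hx s (by omega)
    cases t with
    | zero =>
      rw [digitCode_succ] at h
      simp [digitCode, recState] at h
      omega
    | succ t =>
      have hyt := hy t (by omega)
      rw [digitCode_succ, digitCode_succ] at h
      have hmod := congrArg (· % (M + 1)) h
      simp only [Nat.add_mul_mod_self_left, Nat.mod_eq_of_lt (Nat.lt_succ_of_le hxs.2),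
        Nat.mod_eq_of_lt (Nat.lt_succ_of_le hyt.2)] at hmod
      rw [hmod, add_right_inj] at h
      obtain ⟨rfl, h'⟩ := ih (fun k hk => hx k (by omega)) (fun k hk => hy k (by omega))
        (Nat.eq_of_mul_eq_mul_left (Nat.succ_pos M) h)
      refine ⟨rfl, fun k hk => ?_⟩
      rcases Nat.lt_succ_iff_lt_or_eq.1 hk with hk | rfl
      · exact h' k hk
      · exact hmod

section Decode

/-- Finitely many values are interpolated by a continuous function with the same bound. -/
theorem exists_continuousMap_interpolation (C : Finset ℝ) (r : ℝ → ℝ) {B : ℝ} (hB : 0 ≤ B)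
    (hr : ∀ c ∈ C, |r c| ≤ B) : ∃ h : C(ℝ, ℝ), (∀ c ∈ C, h c = r c) ∧ ∀ s, |h s| ≤ B := by
  classical
  -- Clamping the interpolation polynomial gives the global bound without changing the prescribed
  -- values.
  refine ⟨⟨fun s => max (-B) (min B ((Lagrange.interpolate C id r).eval s)), by fun_prop⟩,
    fun c hc => ?_, fun s => ?_⟩
  · have h := Lagrange.eval_interpolate_at_node r (v := id) (Set.injOn_id _) hc
    have := abs_le.1 (hr c hc)
    simp only [id] at h
    simp only [ContinuousMap.coe_mk]
    rw [h, min_eq_right this.2, max_eq_right this.1]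
  · exact abs_le.2 ⟨le_max_left _ _, max_le (by linarith) (min_le_left _ _)⟩

theorem exists_injOn_near (C : Finset ℝ) (r : ℝ → ℝ) {η : ℝ} (hη : 0 < η) :
    ∃ a : ℝ → ℝ, Set.InjOn a C ∧ ∀ c ∈ C, |a c - r c| < η := by
  classical
  induction C using Finset.induction_on with
  | empty => exact ⟨id, by simp, by simp⟩
  | insert c C hc ih =>
    obtain ⟨a, ha, har⟩ := ih
    obtain ⟨y, hy, hyC⟩ := ((Set.Ioo_infinite (show r c - η < r c + η by linarith)).sdiff
      (C.image a).finite_toSet).nonempty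
    have hne (b : ℝ) (hb : b ∈ C) : b ≠ c := fun h => hc (h ▸ hb)
    refine ⟨Function.update a c y, ?_, fun b hb => ?_⟩
    · rw [Finset.coe_insert, Set.injOn_insert (by simpa using hc)]
      refine ⟨fun b hb b' hb' h => ?_, ?_⟩
      · rw [Function.update_of_ne (hne b hb), Function.update_of_ne (hne b' hb')] at h
        exact ha hb hb' h
      · rintro ⟨b, hb, h⟩
        rw [Function.update_of_ne (hne b hb), Function.update_self] at h
        exact hyC (by rw [← h]; exact Finset.mem_coe.2 (Finset.mem_image_of_mem a hb))
    · rcases Finset.mem_insert.1 hb with rfl | hb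
      · rw [Function.update_self, abs_lt]
        constructor <;> linarith [hy.1, hy.2]
      · rw [Function.update_of_ne (hne b hb)]
        exact har b hb

/-- Codes of vectors can be replaced by codes that approximate an entry of the vectors. -/
theorem exists_decoder {n : ℕ} (C : Finset ℝ) (v : ℝ → Fin n → ℝ) (i : Fin n) {B η : ℝ}
    (hv : ∀ c ∈ C, ∀ j, |v c j| ≤ B) (hB : 0 ≤ B) (hη : 0 < η) :
    ∃ (a : C(ℝ, ℝ)) (g : C(ℝ, Fin n → ℝ)),
      (∀ c ∈ C, |a c - v c i| ≤ η ∧ g (a c) = v c) ∧ ∀ s, |a s| ≤ B + η ∧ ∀ j, |g s j| ≤ B := by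
  classical
  -- Distinct codes may share the entry `v c i`; a perturbation by less than `η` separates them, so
  -- `r c` still determines `c` and `g` can decode from it.
  obtain ⟨r, hr, hrv⟩ := exists_injOn_near C (fun c => v c i) hη
  obtain ⟨a, ha, haB⟩ := exists_continuousMap_interpolation C r (B := B + η) (by linarith)
    fun c hc => by
      have h1 := abs_sub_abs_le_abs_sub (r c) (v c i)
      linarith [hrv c hc, hv c hc i]
  have hinv (c : ℝ) (hc : c ∈ C) : Function.invFunOn r C (r c) = c := hr.leftInvOn_invFunOn hc
  choose g hg hgB using fun j => exists_continuousMap_interpolation (C.image r)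
    (fun y => v (Function.invFunOn r C y) j) hB (by
      intro y hy
      obtain ⟨c, hc, rfl⟩ := Finset.mem_image.1 hy
      rw [hinv c hc]
      exact hv c hc j)
  refine ⟨a, ⟨fun s j => g j s, by fun_prop⟩, fun c hc => ⟨?_, ?_⟩, fun s => ⟨haB s, ?_⟩⟩
  · rw [ha c hc]
    exact (hrv c hc).le
  · funext j
    simp only [ContinuousMap.coe_mk]
    rw [ha c hc, hg j _ (Finset.mem_image_of_mem r hc), hinv c hc]
  · exact fun j => hgB j s

end Decode

section CodeNetwork

variable {dx dy : ℕ}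

/-- Tokens are encoded by `e`, the codes of the tokens are combined to a code of the past, and this
is decoded by `g ∘ a`, where the output of `a` is itself the output register `0`. -/
theorem exists_codeNetwork (N : ℕ) (hdx : 0 < dx) (hdy : 0 < dy) (e : C(Fin dx → ℝ, ℝ)) (β : ℝ)
    (a : C(ℝ, ℝ)) (g : C(ℝ, Fin dy → ℝ)) :
    ∃ T ∈ stackClosure (max (dx + 1) dy + 1) N,
    ∃ (P : (Fin dx → ℝ) →ₗ[ℝ] Fin (max (dx + 1) dy + 1) → ℝ)
      (Q : (Fin (max (dx + 1) dy + 1) → ℝ) →ₗ[ℝ] Fin dy → ℝ), ∀ (x : Fin N → Fin dx → ℝ) (t : Fin N),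
      let s := a (digitCode β (zeroExtend fun k => e (x k)) (t + 1))
      Q (T (fun k => P (x k)) t) = Function.update (g s) ⟨0, hdy⟩ s := by
  set d := max (dx + 1) dy + 1 with hd
  have hd1 : dx + 2 ≤ d := by omega
  have hd2 : dy + 1 ≤ d := by omega
  let ξ (i : Fin dx) : Fin d := ⟨i, by omega⟩
  let υ (j : Fin dy) : Fin d := ⟨j, by omega⟩
  let o : Fin d := ⟨0, by omega⟩
  -- `σ` holds the code and `τ` is the scratch register. Neither is an input, but `σ` may be an
  -- output register, since the code is erased before the outputs are written.
  let σ : Fin d := ⟨d - 2, by omega⟩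
  let τ : Fin d := ⟨d - 1, by omega⟩
  have hξ : Function.Injective ξ := fun i j h => by
    have := congrArg Fin.val h
    exact Fin.ext this
  have hυ : Function.Injective υ := fun i j h => by
    have := congrArg Fin.val h
    exact Fin.ext this
  have hξσ (i : Fin dx) : ξ i ≠ σ := fun h => by
    have := congrArg Fin.val h
    simp only [ξ, σ] at this
    omega
  have hξτ (i : Fin dx) : ξ i ≠ τ := fun h => by
    have := congrArg Fin.val h
    simp only [ξ, τ] at this
    omega
  have hυτ (j : Fin dy) : υ j ≠ τ := fun h => by
    have := congrArg Fin.val h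
    simp only [υ, τ] at this
    omega
  have hoσ : o ≠ σ := fun h => by
    have := congrArg Fin.val h
    simp only [o, σ] at this
    omega
  have hoτ : o ≠ τ := fun h => by
    have := congrArg Fin.val h
    simp only [o, τ] at this
    omega
  have hστ : σ ≠ τ := fun h => by
    have := congrArg Fin.val h
    simp only [σ, τ] at this
    omega
  let write (i : Fin d) : (Unit → ℝ) →ₗ[ℝ] Fin d → ℝ :=
    (LinearMap.proj ()).smulRight (Pi.single i 1)
  have hwrite (i : Fin d) (z : Unit → ℝ) : write i z = z () • Pi.single i 1 := rfl
  have hclear (i : Fin d) (hi : i ≠ τ) (c : ℝ) :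
      clear {τ} (c • Pi.single i 1 : Fin d → ℝ) = c • Pi.single i 1 := by
    funext j
    by_cases hj : j = τ
    · subst hj
      simp [clear_apply, hi.symm]
    · simp [clear_apply, hj]
  let read (i : Fin d) : (Fin d → ℝ) →ₗ[ℝ] Unit → ℝ := LinearMap.funLeft ℝ ℝ fun _ => i
  have hread (i : Fin d) (u : Fin d → ℝ) (j : Unit) : read i u j = u i := rfl
  let P : (Fin dx → ℝ) →ₗ[ℝ] Fin d → ℝ := Function.ExtendByZero.linearMap ℝ ξ
  have hP (z : Fin dx → ℝ) (i : Fin dx) : P z (ξ i) = z i := hξ.extend_apply _ _ i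
  have hPσ (z : Fin dx → ℝ) : P z σ = 0 :=
    Function.extend_apply' _ _ _ fun ⟨i, h⟩ => hξσ i h
  -- Register `o` is never written by `q`: it must remain readable while the other outputs are
  -- decoded from it.
  let q : (Fin dy → ℝ) →ₗ[ℝ] Fin d → ℝ := clear {o} ∘ₗ Function.ExtendByZero.linearMap ℝ υ
  have hqυ (z : Fin dy → ℝ) (j : Fin dy) : q z (υ j) = if υ j = o then 0 else z j := by
    simp only [q, LinearMap.comp_apply, clear_apply, Finset.mem_singleton]
    congr 1
    exact hυ.extend_apply _ _ j
  have hqo (z : Fin dy → ℝ) : q z o = 0 := by simp [q, clear_apply]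
  have hqτ (z : Fin dy → ℝ) : q z τ = 0 := by
    simp only [q, LinearMap.comp_apply, clear_apply, Finset.mem_singleton]
    rw [if_neg hoτ.symm]
    exact Function.extend_apply' _ _ _ fun ⟨j, h⟩ => hυτ j h
  obtain ⟨T₁, hT₁, h₁⟩ := exists_tokenwise_mem N τ (LinearMap.funLeft ℝ ℝ ξ) (write σ)
    (by intro u; funext i; simp [LinearMap.funLeft_apply, clear_apply, hξτ])
    (by intro z; rw [hwrite, hclear σ hστ])
    (by intro z; funext i; simp [LinearMap.funLeft_apply, hwrite, hξσ])
    ⟨fun y _ => e y, by fun_prop⟩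
  obtain ⟨T₂, hT₂, h₂⟩ := exists_linearLayer_mem N (coordSMul σ (Pi.single σ 1))
    (β • coordSMul σ (Pi.single σ 1)) 0
  obtain ⟨T₃, hT₃, h₃⟩ := exists_tokenwise_mem N τ (read σ) (write o)
    (by intro u; funext i; simp [hread, clear_apply, hστ])
    (by intro z; rw [hwrite, hclear o hoτ])
    (by intro z; funext i; simp [hread, hwrite, hoσ.symm])
    ⟨fun y _ => a (y ()), by fun_prop⟩
  obtain ⟨T₄, hT₄, h₄⟩ := exists_tokenwiseLinear_mem N (coordSMul o (Pi.single o 1))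
  obtain ⟨T₅, hT₅, h₅⟩ := exists_tokenwise_mem N τ (read o) q
    (by intro u; funext i; simp [hread, clear_apply, hoτ])
    (by
      intro z
      funext i
      simp only [clear_apply, Finset.mem_singleton]
      split_ifs with h
      · rw [h, hqτ]
      · rfl)
    (by intro z; funext i; simp [hread, hqo])
    ⟨fun y => g (y ()), by fun_prop⟩
  refine ⟨T₅.comp (T₄.comp (T₃.comp (T₂.comp T₁))), comp_mem_stackClosure hT₅
    (comp_mem_stackClosure hT₄ (comp_mem_stackClosure hT₃ (comp_mem_stackClosure hT₂ hT₁))),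
    P, LinearMap.funLeft ℝ ℝ υ, fun x t => ?_⟩
  intro s
  have hcode : T₂ (T₁ fun k => P (x k)) t
      = digitCode β (zeroExtend fun k => e (x k)) (t + 1) • Pi.single σ 1 := by
    rw [h₂, digitCode]
    induction (t : ℕ) + 1 with
    | zero => simp [recState]
    | succ n ih =>
      have hz : zeroExtend (T₁ fun k => P (x k)) n σ = zeroExtend (fun k => e (x k)) n := by
        by_cases hn : n < N
        · have h : (LinearMap.funLeft ℝ ℝ ξ) (P (x ⟨n, hn⟩)) = x ⟨n, hn⟩ := by
            funext i
            exact hP _ i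
          simp [zeroExtend, hn, h₁, clear_apply, hPσ, hwrite, h]
        · simp [zeroExtend, hn]
      rw [recState, ih]
      simp [recState, hz, add_smul, smul_smul, mul_comm β]
  have ho : T₄ (T₃ (T₂ (T₁ fun k => P (x k)))) t = s • Pi.single o 1 := by
    simp [h₄, h₃, hcode, clear_apply, hread, hwrite, hoσ, s]
  funext j
  simp only [ContinuousMap.comp_apply, LinearMap.funLeft_apply, h₅, ho, hclear o hoτ, hread,
    ContinuousMap.coe_mk, Pi.add_apply, hqυ]
  by_cases hj : j = ⟨0, hdy⟩
  · subst hj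
    simp [υ, o]
  · have h : υ j ≠ o := fun h => hj (hυ h)
    simp [h, hj]

end CodeNetwork

/-! ### Quantizing the tokens -/

/-- A compact set consists, up to a small set, of finitely many disjoint small compact sets. -/
theorem exists_disjoint_small_compacts {X : Type*} [MetricSpace X] [MeasurableSpace X]
    [BorelSpace X] (μ : Measure X) [μ.InnerRegularCompactLTTop] [IsFiniteMeasureOnCompacts μ]
    {K : Set X} (hK : IsCompact K) {δ : ℝ} (hδ : 0 < δ) {κ : ℝ≥0∞} (hκ : κ ≠ 0) :
    ∃ (M : ℕ) (G : Fin M → Set X), (∀ i, IsCompact (G i)) ∧ (∀ i, G i ⊆ K) ∧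
      Pairwise (fun i j => Disjoint (G i) (G j)) ∧ (∀ i, ∀ x ∈ G i, ∀ y ∈ G i, dist x y < δ) ∧
      μ (K \ ⋃ i, G i) ≤ κ := by
  obtain ⟨M, b, hb⟩ : ∃ (M : ℕ) (b : Fin M → X), K ⊆ ⋃ i, Metric.ball (b i) (δ / 2) := by
    obtain ⟨s, -, hs, hcov⟩ := hK.finite_cover_balls (half_pos hδ)
    refine ⟨_, fun i => (hs.toFinset.equivFin.symm i : X), fun x hx => ?_⟩
    obtain ⟨c, hc, hxc⟩ := Set.mem_iUnion₂.1 (hcov hx)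
    exact Set.mem_iUnion.2 ⟨hs.toFinset.equivFin ⟨c, by simpa using hc⟩, by simpa using hxc⟩
  -- Each point is assigned to the first ball containing it; inner regularity then replaces these
  -- disjoint sets by compact ones.
  let D (i : Fin M) : Set X := (K ∩ Metric.ball (b i) (δ / 2)) \ ⋃ j < i, Metric.ball (b j) (δ / 2)
  have hDm (i : Fin M) : MeasurableSet (D i) :=
    (hK.measurableSet.inter measurableSet_ball).diff
      (MeasurableSet.iUnion fun j => MeasurableSet.iUnion fun _ => measurableSet_ball)
  have hDK (i : Fin M) : D i ⊆ K := fun x hx => hx.1.1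
  have hDfin (i : Fin M) : μ (D i) ≠ ∞ := measure_ne_top_of_subset (hDK i) hK.measure_ne_top
  have hcover : K ⊆ ⋃ i, D i := by
    intro x hx
    obtain ⟨i, hi, hmin⟩ := WellFounded.has_min (wellFounded_lt (α := Fin M))
      {i | x ∈ Metric.ball (b i) (δ / 2)} (Set.mem_iUnion.1 (hb hx))
    refine Set.mem_iUnion.2 ⟨i, ⟨hx, hi⟩, ?_⟩
    simp only [Set.mem_iUnion, not_exists]
    exact fun j hj hxj => hmin j hxj hj
  have hdisj : Pairwise fun i j => Disjoint (D i) (D j) := by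
    have h (i j : Fin M) (hij : i < j) : Disjoint (D i) (D j) :=
      Set.disjoint_left.2 fun x hi hj => hj.2 (Set.mem_iUnion₂.2 ⟨i, hij, hi.1.2⟩)
    intro i j hij
    rcases lt_or_gt_of_ne hij with hlt | hlt
    · exact h i j hlt
    · exact (h j i hlt).symm
  have hκM : κ / (M + 1) ≠ 0 := (ENNReal.div_pos hκ (by finiteness)).ne'
  choose G hGD hG hGμ using fun i => (hDm i).exists_isCompact_sdiff_lt (hDfin i) hκM
  refine ⟨M, G, hG, fun i => (hGD i).trans (hDK i), fun i j hij =>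
    (hdisj hij).mono (hGD i) (hGD j), fun i x hx y hy => ?_, ?_⟩
  · have h1 := (hGD i hx).1.2
    have h2 := (hGD i hy).1.2
    rw [Metric.mem_ball] at h1 h2
    linarith [dist_triangle_right x y (b i)]
  · calc μ (K \ ⋃ i, G i) ≤ μ (⋃ i, D i \ G i) := by
          refine measure_mono fun x hx => ?_
          obtain ⟨i, hi⟩ := Set.mem_iUnion.1 (hcover hx.1)
          exact Set.mem_iUnion.2 ⟨i, hi, fun h => hx.2 (Set.mem_iUnion.2 ⟨i, h⟩)⟩
      _ ≤ ∑ i, μ (D i \ G i) := measure_iUnion_fintype_le _ _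
      _ ≤ ∑ _i : Fin M, κ / (M + 1) := Finset.sum_le_sum fun i _ => (hGμ i).le
      _ ≤ (M + 1) * (κ / (M + 1)) := by
          rw [Finset.sum_const, Finset.card_univ, Fintype.card_fin, nsmul_eq_mul]
          gcongr
          exact le_self_add
      _ ≤ κ := ENNReal.mul_div_le

/-- A combination of Urysohn functions. Labels start at `1` because the code requires nonzero
digits. -/
theorem exists_continuousMap_label {X : Type*} [TopologicalSpace X] [NormalSpace X] {M : ℕ}
    {G : Fin M → Set X} (hG : ∀ i, IsClosed (G i))
    (hdisj : Pairwise fun i j => Disjoint (G i) (G j)) :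
    ∃ e : C(X, ℝ), ∀ i, ∀ x ∈ G i, e x = ((i + 1 : ℕ) : ℝ) := by
  choose χ h0 h1 _ using fun i => exists_continuous_zero_one_of_isClosed
    (s := ⋃ j ∈ {j | j ≠ i}, G j) (t := G i)
    (Set.Finite.isClosed_biUnion (Set.toFinite _) fun j _ => hG j) (hG i) (by
      simp only [Set.disjoint_iUnion_left]
      exact fun j hj => hdisj hj)
  refine ⟨∑ i : Fin M, ((i + 1 : ℕ) : ℝ) • χ i, fun i x hx => ?_⟩
  rw [ContinuousMap.sum_apply, Finset.sum_eq_single i]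
  · simp [h1 i hx]
  · intro j _ hj
    have : χ j x = 0 := h0 j (Set.mem_iUnion₂.2 ⟨i, hj.symm, hx⟩)
    simp [this]
  · simp

section Encode

variable {dx dy N : ℕ}

/-- The order of quantifiers matters: `D` is fixed before `η` and `κ`, so the exceptional set can
later be made small relative to it. This is possible because the decoders are bounded everywhere,
not only on the codes. -/
theorem exists_codeNetwork_near (hdx : 0 < dx) (hdy : 0 < dy)
    {φ : (Fin N → EuclideanSpace ℝ (Fin dx)) → Fin N → EuclideanSpace ℝ (Fin dy)}
    (hφ : PastDependent φ) (hcont : Continuous φ) {K : Set (EuclideanSpace ℝ (Fin dx))}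
    (hK : IsCompact K) : ∃ D : ℝ, 0 ≤ D ∧ ∀ η : ℝ, 0 < η → ∀ κ : ℝ≥0∞, κ ≠ 0 →
      ∃ 𝒩 : GRUNetwork dx dy (max (dx + 1) dy + 1), 𝒩.IsDeep ∧
      ∃ G ⊆ K, MeasurableSet G ∧ volume (K \ G) ≤ κ ∧
        (∀ x ∈ tokensIn N G, ∀ t, ‖φ x t - 𝒩.toFun x t‖ ≤ η) ∧
        ∀ x ∈ tokensIn N K, ∀ t, ‖φ x t - 𝒩.toFun x t‖ ≤ D := by
  classical
  have hKN := isCompact_tokensIn N hK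
  obtain ⟨B, hB⟩ := hKN.exists_bound_of_continuousOn hcont.continuousOn
  have hBx (x) (hx : x ∈ tokensIn N K) (t : Fin N) : ‖φ x t‖ ≤ max B 0 :=
    (norm_le_pi_norm _ t).trans ((hB x hx).trans (le_max_left _ _))
  have hB0 : 0 ≤ max B 0 := le_max_right _ _
  set B' := max B 0
  let L : (Fin dy → ℝ) →L[ℝ] EuclideanSpace ℝ (Fin dy) :=
    LinearMap.toContinuousLinearMap (WithLp.linearEquiv 2 ℝ (Fin dy → ℝ)).symm.toLinearMap
  have hL (v : Fin dy → ℝ) : L v = WithLp.toLp 2 v := rfl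
  refine ⟨B' + ‖L‖ * (B' + 1) + 1, by positivity, fun η₀ hη₀ κ hκ => ?_⟩
  -- The budget covers quantization (`η`), decoding in the sup norm (`‖L‖ * η`) and approximation by
  -- a network (`η`).
  obtain ⟨η, hη, hη1, hηη⟩ : ∃ η, 0 < η ∧ η ≤ 1 ∧ ‖L‖ * η + 2 * η ≤ η₀ := by
    refine ⟨min 1 (η₀ / (‖L‖ + 2)), by positivity, min_le_left _ _, ?_⟩
    have h : min 1 (η₀ / (‖L‖ + 2)) ≤ η₀ / (‖L‖ + 2) := min_le_right _ _
    rw [le_div_iff₀ (by positivity)] at h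
    linarith
  have hunif := hKN.uniformContinuousOn_of_continuous hcont.continuousOn
  rw [Metric.uniformContinuousOn_iff] at hunif
  obtain ⟨δ, hδ, hδφ⟩ := hunif η hη
  obtain ⟨M, G, hGc, hGK, hGd, hGδ, hGμ⟩ := exists_disjoint_small_compacts volume hK hδ hκ
  obtain ⟨e, he⟩ := exists_continuousMap_label (fun i => (hGc i).isClosed) hGd
  let S (x : Fin N → EuclideanSpace ℝ (Fin dx)) (t : Fin N) : ℝ :=
    digitCode ((M + 1 : ℕ) : ℝ) (zeroExtend fun k => e (x k)) (t + 1)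
  let S' (i : Fin N → Fin M) (t : Fin N) : ℕ :=
    digitCode (M + 1) (zeroExtend fun k => (i k + 1 : ℕ)) (t + 1)
  have hS {x : Fin N → EuclideanSpace ℝ (Fin dx)} {i : Fin N → Fin M} (hx : ∀ k, x k ∈ G (i k))
      (t : Fin N) : S x t = S' i t := by
    refine digitCode_natCast (M + 1) fun k hk => ?_
    have hk : k < N := by omega
    simp [zeroExtend, hk, he _ _ (hx _)]
  have hlab (x) (hx : x ∈ tokensIn N (⋃ i, G i)) : ∃ i : Fin N → Fin M, ∀ k, x k ∈ G (i k) := by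
    choose i hi using fun k => Set.mem_iUnion.1 (hx k)
    exact ⟨i, hi⟩
  have hGN (x) (hx : x ∈ tokensIn N (⋃ i, G i)) : x ∈ tokensIn N K :=
    fun k => Set.iUnion_subset hGK (hx k)
  have hSφ {x y} (hx : x ∈ tokensIn N (⋃ i, G i)) (hy : y ∈ tokensIn N (⋃ i, G i)) {s t : Fin N}
      (h : S x s = S y t) : ‖φ x s - φ y t‖ ≤ η := by
    obtain ⟨i, hi⟩ := hlab x hx
    obtain ⟨j, hj⟩ := hlab y hy
    rw [hS hi, hS hj, Nat.cast_inj] at h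
    have hdig (i : Fin N → Fin M) (t : Fin N) : ∀ k < (t : ℕ) + 1,
        1 ≤ zeroExtend (fun k => (i k + 1 : ℕ)) k ∧ zeroExtend (fun k => (i k + 1 : ℕ)) k ≤ M := by
      intro k hk
      have hk : k < N := by omega
      simp only [zeroExtend, hk, dite_true]
      omega
    obtain ⟨hst, hij⟩ := digitCode_inj (hdig i s) (hdig j t) h
    have hst : s = t := by ext; omega
    subst hst
    have hxy : ∀ k ≤ s, dist (x k) (y k) < δ := by
      intro k hk
      have h1 := hij k (Nat.lt_succ_of_le hk)
      rw [zeroExtend_val, zeroExtend_val, add_left_inj] at h1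
      have h2 : i k = j k := Fin.ext h1
      exact hGδ (i k) _ (hi k) _ (h2 ▸ hj k)
    -- Equal codes control the tokens only up to `s`. Splicing `y` with the future of `x` gives a
    -- globally close sequence with the same value of `φ` at `s`.
    let y' : Fin N → EuclideanSpace ℝ (Fin dx) := fun k => if k ≤ s then y k else x k
    have hy' : φ y' s = φ y s := hφ.congr fun k hk => by simp [y', hk]
    have hy'K : y' ∈ tokensIn N K := fun k => by
      by_cases hk : k ≤ s
      · simpa [y', hk] using hGN y hy k
      · simpa [y', hk] using hGN x hx k
    have hdist : dist x y' < δ := by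
      rw [dist_pi_lt_iff hδ]
      intro k
      by_cases hk : k ≤ s
      · simpa [y', hk] using hxy k hk
      · simpa [y', hk] using hδ
    rw [← hy', ← dist_eq_norm]
    exact (dist_le_pi_dist _ _ s).trans (hδφ x (hGN x hx) y' hy'K hdist).le
  -- The value at a code comes from an arbitrary representative; by `hSφ` the choice costs at most
  -- `η`.
  let v (c : ℝ) : Fin dy → ℝ :=
    if h : ∃ x ∈ tokensIn N (⋃ i, G i), ∃ t, S x t = c then (φ h.choose h.choose_spec.2.choose).ofLp
    else 0
  have hv {x} (hx : x ∈ tokensIn N (⋃ i, G i)) (t : Fin N) : ‖WithLp.toLp 2 (v (S x t)) - φ x t‖ ≤ η := by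
    have h : ∃ y ∈ tokensIn N (⋃ i, G i), ∃ s, S y s = S x t := ⟨x, hx, t, rfl⟩
    simp only [v, h, dite_true]
    exact hSφ h.choose_spec.1 hx h.choose_spec.2.choose_spec
  have hvB (c : ℝ) (j : Fin dy) : |v c j| ≤ B' := by
    simp only [v]
    split_ifs with h
    · exact (PiLp.norm_apply_le _ j).trans (hBx _ (hGN _ h.choose_spec.1) _)
    · simpa using hB0
  let C : Finset ℝ := Finset.univ.image fun q : (Fin N → Fin M) × Fin N => (S' q.1 q.2 : ℝ)
  obtain ⟨a, g, hag, hagB⟩ := exists_decoder C v ⟨0, hdy⟩ (fun c _ => hvB c) hB0 hη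
  obtain ⟨T, hT, P, Q, hTPQ⟩ := exists_codeNetwork N hdx hdy
    ⟨fun y => e (WithLp.toLp 2 y), by fun_prop⟩ ((M + 1 : ℕ) : ℝ) a g
  obtain ⟨𝒩, hdeep, h𝒩⟩ := exists_network_near hT P Q hK hη
  have hout (x : Fin N → EuclideanSpace ℝ (Fin dx)) (t : Fin N) :
      Q (T (fun k => P (x k).ofLp) t) = Function.update (g (a (S x t))) ⟨0, hdy⟩ (a (S x t)) :=
    hTPQ (fun k => (x k).ofLp) t
  refine ⟨𝒩, hdeep, ⋃ i, G i, Set.iUnion_subset hGK,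
    MeasurableSet.iUnion fun i => (hGc i).measurableSet, hGμ, fun x hx t => ?_, fun x hx t => ?_⟩
  · have h1 := h𝒩 x (hGN x hx) t
    rw [hout] at h1
    obtain ⟨i, hi⟩ := hlab x hx
    have hC : S x t ∈ C := Finset.mem_image.2 ⟨(i, t), Finset.mem_univ _, (hS hi t).symm⟩
    have h2 : ‖v (S x t) - Function.update (g (a (S x t))) ⟨0, hdy⟩ (a (S x t))‖ ≤ η := by
      rw [pi_norm_le_iff_of_nonneg hη.le]
      intro j
      rw [(hag _ hC).2, Pi.sub_apply, Real.norm_eq_abs, abs_sub_comm]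
      by_cases hj : j = ⟨0, hdy⟩
      · subst hj
        rw [Function.update_self]
        exact (hag _ hC).1
      · rw [Function.update_of_ne hj, sub_self, abs_zero]
        exact hη.le
    have h3 := (L.le_opNorm _).trans (mul_le_mul_of_nonneg_left h2 (norm_nonneg L))
    rw [map_sub, hL] at h3
    rw [← hL] at h1
    set w := L (Function.update (g (a (S x t))) ⟨0, hdy⟩ (a (S x t)))
    have h4 := hv hx t
    rw [norm_sub_rev] at h4
    set c := WithLp.toLp 2 (v (S x t))
    calc ‖φ x t - 𝒩.toFun x t‖ = ‖(φ x t - c) + (c - w) + (w - 𝒩.toFun x t)‖ := by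
          congr 1
          abel
      _ ≤ ‖φ x t - c‖ + ‖c - w‖ + ‖w - 𝒩.toFun x t‖ := norm_add₃_le
      _ ≤ _ := by linarith
  · have h1 := h𝒩 x hx t
    rw [hout] at h1
    have h2 : ‖Function.update (g (a (S x t))) ⟨0, hdy⟩ (a (S x t))‖ ≤ B' + 1 := by
      rw [pi_norm_le_iff_of_nonneg (by positivity)]
      intro j
      rw [Real.norm_eq_abs]
      by_cases hj : j = ⟨0, hdy⟩
      · subst hj
        rw [Function.update_self]
        exact (hagB _).1.trans (by linarith)
      · rw [Function.update_of_ne hj]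
        exact ((hagB _).2 j).trans (by linarith)
    rw [← hL] at h1
    have h3 := (L.le_opNorm _).trans (mul_le_mul_of_nonneg_left h2 (norm_nonneg L))
    set w := L (Function.update (g (a (S x t))) ⟨0, hdy⟩ (a (S x t)))
    calc ‖φ x t - 𝒩.toFun x t‖ ≤ ‖φ x t - w‖ + ‖w - 𝒩.toFun x t‖ :=
          norm_sub_le_norm_sub_add_norm_sub ..
      _ ≤ (‖φ x t‖ + ‖w‖) + 1 := add_le_add (norm_sub_le _ _) (h1.le.trans hη1)
      _ ≤ _ := by linarith [hBx x hx t]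

end Encode

/-! ### Approximation in `L^p` -/

section Lp

variable {dx dy N : ℕ}

theorem volume_restrict_tokensIn (N : ℕ) (K : Set (EuclideanSpace ℝ (Fin dx))) :
    (volume : Measure (Fin N → EuclideanSpace ℝ (Fin dx))).restrict (tokensIn N K)
      = Measure.pi fun _ => volume.restrict K := by
  have : tokensIn N K = Set.univ.pi fun _ => K := by
    ext x
    simp [tokensIn]
  rw [this, volume_pi, Measure.restrict_pi_pi]

/-- Past-dependence supplies `g` with no measurability. The pushforward is a multiple of the product
over the retained coordinates, and measurability descends to that factor because the complementary
factor has nonzero mass. -/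
theorem aestronglyMeasurable_map_restrict {ι X Y : Type*} [Fintype ι] [MeasurableSpace X]
    [TopologicalSpace Y] (ν : Measure X) [IsFiniteMeasure ν]
    (h0 : ν Set.univ ≠ 0) (p : ι → Prop) [DecidablePred p] (g : ({i // p i} → X) → Y)
    (h : AEStronglyMeasurable (fun x => g fun i => x i) (Measure.pi fun _ : ι => ν)) :
    AEStronglyMeasurable g ((Measure.pi fun _ : ι => ν).map fun x (i : {i // p i}) => x i) := by
  have hmp := measurePreserving_piEquivPiSubtypeProd (fun _ : ι => ν) p
  have hmap : ((Measure.pi fun _ : ι => ν).map fun x (i : {i // p i}) => x i)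
      = (Measure.pi fun _ : {i // ¬ p i} => ν) Set.univ • Measure.pi fun _ : {i // p i} => ν := by
    rw [← Measure.map_fst_prod, ← hmp.map_eq,
      Measure.map_map measurable_fst (MeasurableEquiv.measurable _)]
    rfl
  rw [hmap]
  refine AEStronglyMeasurable.smul_measure ?_ _
  refine AEStronglyMeasurable.of_comp_fst (ν := Measure.pi fun _ : {i // ¬ p i} => ν) ?_ ?_
  · rw [← hmp.map_eq]
    exact (MeasurableEquiv.measurableEmbedding _).aestronglyMeasurable_map_iff.2 h
  · rw [Ne, ← Measure.measure_univ_eq_zero, Measure.pi_univ]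
    exact Finset.prod_ne_zero_iff.2 fun _ _ => h0

/-- A past-dependent function in `L^p` can be approximated by continuous past-dependent ones. -/
theorem exists_continuous_pastDependent_near
    {f : (Fin N → EuclideanSpace ℝ (Fin dx)) → Fin N → EuclideanSpace ℝ (Fin dy)}
    (hf : PastDependent f) {K : Set (EuclideanSpace ℝ (Fin dx))} (hK : IsCompact K) {p : ℝ≥0∞}
    (hp : p ≠ ∞) (hfp : MemLp f p (volume.restrict (tokensIn N K))) {θ : ℝ≥0∞} (hθ : θ ≠ 0) :
    ∃ φ : (Fin N → EuclideanSpace ℝ (Fin dx)) → Fin N → EuclideanSpace ℝ (Fin dy),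
      PastDependent φ ∧ Continuous φ ∧ ∀ t,
        eLpNorm (fun x => f x t - φ x t) p (volume.restrict (tokensIn N K)) ≤ θ := by
  rw [volume_restrict_tokensIn] at *
  set ν : Measure (EuclideanSpace ℝ (Fin dx)) := volume.restrict K
  have : IsFiniteMeasure ν := ⟨by simpa [ν] using hK.measure_lt_top⟩
  rcases eq_or_ne (ν Set.univ) 0 with h0 | h0
  · refine ⟨fun _ _ => 0, ⟨fun _ _ => 0, fun _ _ => rfl⟩, continuous_const, fun t => ?_⟩
    have : Measure.pi (fun _ : Fin N => ν) = 0 := by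
      rw [← Measure.measure_univ_eq_zero, Measure.pi_univ]
      exact Finset.prod_eq_zero (Finset.mem_univ t) h0
    simp [this]
  obtain ⟨g, hg⟩ := hf
  let r (t : Fin N) (x : Fin N → EuclideanSpace ℝ (Fin dx)) :
    Set.Iic t → EuclideanSpace ℝ (Fin dx) := fun s => x s
  have hr (t : Fin N) : Continuous (r t) := by fun_prop
  -- Approximating `g t` on the space of pasts, rather than `f` itself, keeps the continuous
  -- approximant past-dependent.
  have hgt (t : Fin N) : MemLp (g t) p ((Measure.pi fun _ => ν).map (r t)) := by
    have hft : MemLp (g t ∘ r t) p (Measure.pi fun _ => ν) := by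
      have : (fun x => f x t) = g t ∘ r t := funext fun x => hg x t
      rw [← this]
      exact hfp.mono ((continuous_apply t).comp_aestronglyMeasurable hfp.1)
        (.of_forall fun x => norm_le_pi_norm (f x) t)
    refine (memLp_map_measure_iff ?_ (hr t).measurable.aemeasurable).2 hft
    exact aestronglyMeasurable_map_restrict ν h0 (· ∈ Set.Iic t) (g t) hft.1
  choose φ hφ _ using fun t => (hgt t).exists_boundedContinuous_eLpNorm_sub_le hp hθ
  refine ⟨fun x t => φ t (r t x), ⟨fun t => φ t, fun _ _ => rfl⟩, by fun_prop, fun t => ?_⟩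
  have h := hφ t
  rw [eLpNorm_map_measure ((hgt t).1.sub (φ t).continuous.aestronglyMeasurable)
    (hr t).measurable.aemeasurable] at h
  have hgφ : (fun x => f x t - φ t (r t x)) = (g t - ⇑(φ t)) ∘ r t := by
    funext x
    simp [hg, r]
  rw [hgφ]
  exact h

/-- A union bound over the times at which the token leaves `G`. -/
theorem measure_compl_tokensIn_le (N : ℕ) (ν : Measure (EuclideanSpace ℝ (Fin dx)))
    [IsFiniteMeasure ν] {G : Set (EuclideanSpace ℝ (Fin dx))} (hG : MeasurableSet G) :
    Measure.pi (fun _ : Fin N => ν) (tokensIn N G)ᶜ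
      ≤ (∑ t : Fin N, ∏ _j ∈ Finset.univ.erase t, ν Set.univ) * ν Gᶜ := by
  have : (tokensIn N G)ᶜ = ⋃ t, Function.eval t ⁻¹' Gᶜ := by
    ext x
    simp [tokensIn]
  rw [this, Finset.sum_mul]
  refine (measure_iUnion_fintype_le _ _).trans (Finset.sum_le_sum fun t _ => ?_)
  rw [← Measure.map_apply (measurable_pi_apply t) hG.compl, Measure.pi_map_eval]
  simp

theorem exists_Lp_approximation (hdx : 0 < dx) (hdy : 0 < dy)
    {f : (Fin N → EuclideanSpace ℝ (Fin dx)) → Fin N → EuclideanSpace ℝ (Fin dy)}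
    (hf : PastDependent f) {K : Set (EuclideanSpace ℝ (Fin dx))} (hK : IsCompact K) {p : ℝ≥0∞}
    (hp1 : 1 ≤ p) (hp : p ≠ ∞) (hfp : MemLp f p (volume.restrict (tokensIn N K))) {θ : ℝ≥0∞}
    (hθ : θ ≠ 0) (hθ' : θ ≠ ∞) :
    ∃ 𝒩 : GRUNetwork dx dy (max (dx + 1) dy + 1), 𝒩.IsDeep ∧ ∀ t,
      eLpNorm (fun x => f x t - 𝒩.toFun x t) p (volume.restrict (tokensIn N K))
        ≤ θ + (θ + θ) := by
  obtain ⟨φ, hφ, hφc, hfφ⟩ := exists_continuous_pastDependent_near hf hK hp hfp hθ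
  obtain ⟨D, hD, hnet⟩ := exists_codeNetwork_near hdx hdy hφ hφc hK
  have hp0 : p ≠ 0 := (zero_lt_one.trans_le hp1).ne'
  have hpr : 0 < p.toReal := ENNReal.toReal_pos hp0 hp
  have hmem : ∀ᵐ x ∂(volume.restrict (tokensIn N K)), x ∈ tokensIn N K :=
    ae_restrict_mem (isCompact_tokensIn N hK).measurableSet
  rw [volume_restrict_tokensIn] at *
  set ν : Measure (EuclideanSpace ℝ (Fin dx)) := volume.restrict K with hν
  have : IsFiniteMeasure ν := ⟨by simpa [ν] using hK.measure_lt_top⟩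
  set μ := Measure.pi fun _ : Fin N => ν
  set C : ℝ≥0∞ := ∑ t : Fin N, ∏ _j ∈ Finset.univ.erase t, ν Set.univ with hC
  have hCtop : C ≠ ∞ := by
    exact ENNReal.sum_ne_top.2 fun t _ => ENNReal.prod_ne_top fun _ _ => measure_ne_top _ _
  set V : ℝ≥0∞ := μ Set.univ ^ (1 / p.toReal) with hV
  have hVtop : V ≠ ∞ := ENNReal.rpow_ne_top_of_nonneg (by positivity) (by finiteness)
  have hη : θ / (V + 1) ≠ 0 := (ENNReal.div_pos hθ (by finiteness)).ne'
  have hη' : θ / (V + 1) ≠ ∞ := (ENNReal.div_lt_top hθ' (by simp)).ne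
  -- This `κ` makes the bad sequences contribute at most `θ` to the norm when the error there is
  -- `D`. Adding `1` to `D`, `C` and `V` avoids division by zero.
  have hκ : (θ / (‖D‖ₑ + 1)) ^ p.toReal / (C + 1) ≠ 0 := by
    refine (ENNReal.div_pos ?_ (by finiteness)).ne'
    exact (ENNReal.rpow_pos_of_nonneg (ENNReal.div_pos hθ (by finiteness)) hpr.le).ne'
  obtain ⟨𝒩, hdeep, G, hGK, hGm, hGκ, hG, hKD⟩ :=
    hnet _ (ENNReal.toReal_pos hη hη') _ hκ
  set η : ℝ := (θ / (V + 1)).toReal with hηdef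
  have hηe : ‖η‖ₑ = θ / (V + 1) := by
    rw [Real.enorm_eq_ofReal ENNReal.toReal_nonneg, ENNReal.ofReal_toReal hη']
  have hbadm : MeasurableSet (tokensIn N G)ᶜ := by
    have : tokensIn N G = ⋂ t, Function.eval t ⁻¹' G := by
      ext x
      simp [tokensIn]
    rw [this]
    exact (MeasurableSet.iInter fun t => hGm.preimage (measurable_pi_apply t)).compl
  have hbad : μ (tokensIn N G)ᶜ ≤ (θ / (‖D‖ₑ + 1)) ^ p.toReal := by
    refine (measure_compl_tokensIn_le N ν hGm).trans ?_
    have : ν Gᶜ = volume (K \ G) := by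
      rw [hν, Measure.restrict_apply hGm.compl, Set.inter_comm, Set.sdiff_eq]
    rw [this]
    calc C * volume (K \ G) ≤ (C + 1) * ((θ / (‖D‖ₑ + 1)) ^ p.toReal / (C + 1)) := by
          gcongr
          exact le_self_add
      _ ≤ _ := ENNReal.mul_div_le
  refine ⟨𝒩, hdeep, fun t => ?_⟩
  have hft : AEStronglyMeasurable (fun x => ‖f x t - φ x t‖) μ :=
    (((continuous_apply t).comp_aestronglyMeasurable hfp.1).sub
      ((continuous_apply t).comp hφc).aestronglyMeasurable).norm
  have hind : AEStronglyMeasurable ((tokensIn N G)ᶜ.indicator fun _ => D) μ :=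
    (stronglyMeasurable_const.indicator hbadm).aestronglyMeasurable
  let F₁ (x : Fin N → EuclideanSpace ℝ (Fin dx)) : ℝ := ‖f x t - φ x t‖
  let F₂ (x : Fin N → EuclideanSpace ℝ (Fin dx)) : ℝ := η
  let F₃ : (Fin N → EuclideanSpace ℝ (Fin dx)) → ℝ := (tokensIn N G)ᶜ.indicator fun _ => D
  -- The summands are the error of the continuous approximant, the error on good sequences and the
  -- crude bound on bad ones. Comparing real functions avoids proving the network measurable.
  have hbound : ∀ᵐ x ∂μ, ‖f x t - 𝒩.toFun x t‖ ≤ (F₁ + (F₂ + F₃)) x := by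
    filter_upwards [hmem] with x hx
    refine (norm_sub_le_norm_sub_add_norm_sub _ (φ x t) _).trans ?_
    simp only [Pi.add_apply, F₁, F₂, F₃]
    gcongr
    by_cases hxG : x ∈ tokensIn N G
    · simpa [hxG] using hG x hxG t
    · simp only [Set.mem_compl_iff, hxG, not_false_eq_true, Set.indicator_of_mem]
      linarith [hKD x hx t, ENNReal.toReal_nonneg (a := θ / (V + 1))]
  refine (eLpNorm_mono_ae_real hbound).trans ?_
  refine (eLpNorm_add_le hft (aestronglyMeasurable_const.add hind) hp1).trans ?_
  refine add_le_add ((eLpNorm_norm _).trans_le (hfφ t)) ?_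
  refine (eLpNorm_add_le aestronglyMeasurable_const hind hp1).trans (add_le_add ?_ ?_)
  · rw [eLpNorm_const' _ hp0 hp, hηe, ← hV, mul_comm]
    calc V * (θ / (V + 1)) ≤ (V + 1) * (θ / (V + 1)) := by
          gcongr
          exact le_self_add
      _ ≤ θ := ENNReal.mul_div_le
  · rw [eLpNorm_indicator_const hbadm hp0 hp]
    calc ‖D‖ₑ * μ (tokensIn N G)ᶜ ^ (1 / p.toReal)
        ≤ (‖D‖ₑ + 1) * ((θ / (‖D‖ₑ + 1)) ^ p.toReal) ^ (1 / p.toReal) := by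
          gcongr
          exact le_self_add
      _ = (‖D‖ₑ + 1) * (θ / (‖D‖ₑ + 1)) := by
          rw [one_div, ENNReal.rpow_rpow_inv hpr.ne']
      _ ≤ θ := ENNReal.mul_div_le

end Lp

theorem mainTheorem7 (dx dy N : ℕ) (hdx : 0 < dx) (hdy : 0 < dy) (hN : 0 < N)
    (f : (Fin N → EuclideanSpace ℝ (Fin dx)) → Fin N → EuclideanSpace ℝ (Fin dy))
    (hf : PastDependent f)
    (K : Set (EuclideanSpace ℝ (Fin dx))) (hK : IsCompact K) (ε : ℝ) (hε : 0 < ε) :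
    (Continuous f →
      ∃ 𝒩 : GRUNetwork dx dy (dx + dy + 3), 𝒩.IsDeep ∧
        (⨆ x ∈ tokensIn N K, ⨆ t : Fin N, ‖f x t - 𝒩.toFun x t‖ₑ) < ENNReal.ofReal ε) ∧
    (∀ p : ℝ≥0∞, 1 ≤ p → p ≠ ∞ → MemLp f p (volume.restrict (tokensIn N K)) →
      ∃ 𝒩 : GRUNetwork dx dy (max (dx + 1) dy + 1), 𝒩.IsDeep ∧
        (⨆ t : Fin N, eLpNorm (fun x => f x t - 𝒩.toFun x t) p
          (volume.restrict (tokensIn N K))) < ENNReal.ofReal ε) := by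
  refine ⟨fun hcont => ?_, fun p hp1 hp hfp => ?_⟩
  · obtain ⟨𝒩, hdeep, h⟩ := exists_uniform_approximation hf hcont hK (half_pos hε)
    refine ⟨𝒩, hdeep, lt_of_le_of_lt (b := ENNReal.ofReal (ε / 2)) ?_
      ((ENNReal.ofReal_lt_ofReal_iff hε).2 (half_lt_self hε))⟩
    refine iSup₂_le fun x hx => iSup_le fun t => ?_
    rw [← ofReal_norm]
    exact ENNReal.ofReal_le_ofReal (h x hx t).le
  · obtain ⟨𝒩, hdeep, h⟩ := exists_Lp_approximation hdx hdy hf hK hp1 hp hfp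
      -- Three errors of `ε / 4` stay strictly below `ε`, also after the supremum over `t`.
      (θ := ENNReal.ofReal (ε / 4)) (ENNReal.ofReal_pos.2 (by positivity)).ne'
      ENNReal.ofReal_ne_top
    refine ⟨𝒩, hdeep, lt_of_le_of_lt (iSup_le h) ?_⟩
    rw [← ENNReal.ofReal_add (by positivity) (by positivity),
      ← ENNReal.ofReal_add (by positivity) (by positivity)]
    exact (ENNReal.ofReal_lt_ofReal_iff hε).2 (by linarith)
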